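/- Let $\mathsf G$ be a discrete group which is rigidly symmetric: for every $C^*$-algebra $\mathcal B$ the Banach $^*$-algebra $\ell^1(\mathsf G;\mathcal B)\cong\ell^1(\mathsf G)\widehat\otimes\mathcal B$, with product $(f\star g)(x)=\sum_{y}f(y)g(y^{-1}x)$ and involution $f^\star(x)=f(x^{-1})^*$, is symmetric, i.e. every element of the form $f^\star\star f$ has spectrum contained in $[0,\infty)$. Let $(\alpha,\omega)$ be a twisted action of $\mathsf G$ on a unital $C^*$-algebra $\mathcal A$: maps $\alpha:\mathsf G\to\mathrm{Aut}(\mathcal A)$ and $\omega:\mathsf G\times\mathsf G\to\mathcal U(\mathcal A)$ (the unitary group of $\mathcal A$) such that, for all $x,y,z\in\mathsf G$ and $a\in\mathcal A$ (with $\mathsf e$ the unit of $\mathsf G$), $\alpha_x(\alpha_y(a))=\omega(x,y)\,\alpha_{xy}(a)\,\omega(x,y)^*$, $\ \omega(x,y)\,\omega(xy,z)=\alpha_x(\omega(y,z))\,\omega(x,yz)$ and $\omega(x,\mathsf e)=1=\omega(\mathsf e,x)$. Let $\ell^1_{\alpha,\omega}(\mathsf G;\mathcal A)$ be the Banach $^*$-algebra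 of absolutely summable functions $f:\mathsf G\to\mathcal A$ with $$(f\diamond g)(x)=\sum_{y\in\mathsf G}f(y)\,\alpha_y[g(y^{-1}x)]\,\omega(y,y^{-1}x),\qquad f^{\diamond}(x)=\omega(x,x^{-1})^*\,\alpha_x[f(x^{-1})]^*,$$ and let $\mathcal A\rtimes_\alpha^\omega\mathsf G$ be its enveloping $C^*$-algebra. Let $\mathcal J$ be a closed self-adjoint two-sided ideal of $\mathcal A$ with $\alpha_x(\mathcal J)\subset\mathcal J$ for all $x\in\mathsf G$, and let $\mathcal J\rtimes_\alpha^\omega\mathsf G$ be the corresponding ideal of $\mathcal A\rtimes_\alpha^\omega\mathsf G$, i.e. the closure of the image of $\ell^1_{\alpha,\omega}(\mathsf G;\mathcal J)$. Let $\Pi:\mathcal A\rtimes_\alpha^\omega\mathsf G\to\mathbb B(\mathscr H)$ be a faithful $^*$-representation on a Hilbert space $\mathscr H$ such that $\Pi[\mathcal J\rtimes_\alpha^\omega\mathsf G]=\mathbb K(\mathscr H)$, the ideal of compact operators. Then the $^*$-algebra $\Pi[\ell^1_{\alpha,\omega}(\mathsf G;\mathcal A)]$ is Fredholm inverse closed: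 for every Fredholm operator $T\in\Pi[\ell^1_{\alpha,\omega}(\mathsf G;\mathcal A)]$ (closed range, finite-dimensional $\ker T$ and $\ker T^*$) there exist $S\in\Pi[\ell^1_{\alpha,\omega}(\mathsf G;\mathcal A)]$ and $K,L\in\mathbb K(\mathscr H)$ with $ST=1+K$ and $TS=1+L$. -/

import Mathlib

open scoped ENNReal

set_option linter.unusedSectionVars false

universe u v w

noncomputable section

namespace TwistedCrossed

/-! ### Weighted convolution on `ℓ¹(G; A)` -/

section Fibers

/-- The data needed to convolve `A`-valued functions on `G`: products
`a, b ↦ mul x y a b` (of a value at `x` and a value at `y`, giving a value at `x * y`) and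
involutions `a ↦ inv x a` (of a value at `x⁻¹`, giving a value at `x`), subject to the laws
that turn `ℓ¹(G; A)` into a Banach `*`-algebra. Only two instances are used below: the
one of a twisted action (`TwistedAction.fibers`) and the plain one (`plainFibers`). -/
structure FiberStructure (G : Type u) [Group G] (A : Type v) [NormedAddCommGroup A]
    [NormedSpace ℂ A] where
  mul : G → G → A →L[ℂ] A →L[ℂ] A
  inv : G → A →L⋆[ℂ] A
  norm_mul_le : ∀ x y a b, ‖mul x y a b‖ ≤ ‖a‖ * ‖b‖
  mul_assoc : ∀ x y z a b c,
    mul (x * y) z (mul x y a b) c = mul x (y * z) a (mul y z b c)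
  norm_inv : ∀ x a, ‖inv x a‖ = ‖a‖
  inv_inv : ∀ x a, inv x (inv x⁻¹ a) = a
  inv_mul : ∀ x y a b,
    inv (x * y)⁻¹ (mul x y a b) = mul y⁻¹ x⁻¹ (inv y⁻¹ b) (inv x⁻¹ a)

variable {G : Type u} [Group G] {A : Type v} [NormedAddCommGroup A] [NormedSpace ℂ A]

/-- The Banach space `ℓ¹(G; A)`, to be equipped with the convolution and the involution
determined by `S`. -/
def L1 (_S : FiberStructure G A) : Type (max u v) := lp (fun _ : G => A) 1

namespace L1

variable {S : FiberStructure G A}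

instance : NormedAddCommGroup (L1 S) := inferInstanceAs (NormedAddCommGroup (lp (fun _ : G => A) 1))

instance : NormedSpace ℂ (L1 S) := inferInstanceAs (NormedSpace ℂ (lp (fun _ : G => A) 1))

instance [CompleteSpace A] : CompleteSpace (L1 S) :=
  inferInstanceAs (CompleteSpace (lp (fun _ : G => A) 1))

/-- The function underlying an element of `ℓ¹(G; A)`. -/
def toFun (f : L1 S) : G → A := f.1

instance : CoeFun (L1 S) (fun _ => G → A) := ⟨toFun⟩

theorem ext {f g : L1 S} (h : ∀ x, f x = g x) : f = g := lp.ext (funext h)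

@[simp] theorem add_apply (f g : L1 S) (x : G) : (f + g) x = f x + g x := rfl

@[simp] theorem zero_apply (x : G) : (0 : L1 S) x = 0 := rfl

@[simp] theorem smul_apply (c : ℂ) (f : L1 S) (x : G) : (c • f) x = c • f x := rfl

theorem memlp_one_iff {f : G → A} : Memℓp f 1 ↔ Summable fun x => ‖f x‖ := by
  simpa using memℓp_gen_iff (p := 1) (f := f) (by simp)

theorem summable_norm (f : L1 S) : Summable fun x => ‖f x‖ := memlp_one_iff.1 f.2

/-- An absolutely summable function as an element of `ℓ¹(G; A)`. -/
def mk (f : G → A) (hf : Summable fun x => ‖f x‖) : L1 S := ⟨f, memlp_one_iff.2 hf⟩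

@[simp] theorem mk_apply (f : G → A) (hf : Summable fun x => ‖f x‖) (x : G) :
    (mk f hf : L1 S) x = f x := rfl

theorem norm_eq (f : L1 S) : ‖f‖ = ∑' x, ‖f x‖ := by
  have := lp.norm_eq_tsum_rpow (p := 1) (by simp) (show lp (fun _ : G => A) 1 from f)
  simp only [ENNReal.toReal_one, Real.rpow_one, one_div, inv_one] at this
  exact this

theorem norm_apply_le (f : L1 S) (x : G) : ‖f x‖ ≤ ‖f‖ := by
  rw [norm_eq]
  exact (summable_norm f).le_tsum x fun _ _ => norm_nonneg _

theorem summable_prod (f g : L1 S) :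
    Summable fun p : G × G => ‖f p.1‖ * ‖g (p.1⁻¹ * p.2)‖ := by
  have h := (summable_norm f).mul_of_nonneg (summable_norm g)
    (fun _ => norm_nonneg _) (fun _ => norm_nonneg _)
  have := (Equiv.prodShear (Equiv.refl G) fun y : G => Equiv.mulLeft y⁻¹).summable_iff.2 h
  simpa [Function.comp_def] using this

theorem tsum_prod (f g : L1 S) :
    ∑' p : G × G, ‖f p.1‖ * ‖g (p.1⁻¹ * p.2)‖ = ‖f‖ * ‖g‖ := by
  have h := (summable_norm f).mul_of_nonneg (summable_norm g)
    (fun _ => norm_nonneg _) (fun _ => norm_nonneg _)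
  have e := (Equiv.prodShear (Equiv.refl G) fun y : G => Equiv.mulLeft y⁻¹).tsum_eq
    (fun p : G × G => ‖f p.1‖ * ‖g p.2‖)
  rw [norm_eq, norm_eq, (summable_norm f).tsum_mul_tsum (summable_norm g) h, ← e]
  rfl

theorem summable_swap (f g : L1 S) :
    Summable fun p : G × G => ‖f p.2‖ * ‖g (p.2⁻¹ * p.1)‖ :=
  (summable_prod f g).prod_symm

theorem summable_at (f g : L1 S) (x : G) : Summable fun y => ‖f y‖ * ‖g (y⁻¹ * x)‖ :=
  (summable_swap f g).prod_factor x

theorem summable_norm_conv (f g : L1 S) (x : G) :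
    Summable fun y => ‖S.mul y (y⁻¹ * x) (f y) (g (y⁻¹ * x))‖ :=
  (summable_at f g x).of_nonneg_of_le (fun _ => norm_nonneg _)
    fun _ => S.norm_mul_le _ _ _ _

variable [CompleteSpace A]

theorem summable_conv (f g : L1 S) (x : G) :
    Summable fun y => S.mul y (y⁻¹ * x) (f y) (g (y⁻¹ * x)) :=
  (summable_norm_conv f g x).of_norm

theorem norm_conv_le (f g : L1 S) (x : G) :
    ‖∑' y, S.mul y (y⁻¹ * x) (f y) (g (y⁻¹ * x))‖ ≤ ∑' y, ‖f y‖ * ‖g (y⁻¹ * x)‖ :=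
  (norm_tsum_le_tsum_norm (summable_norm_conv f g x)).trans <|
    (summable_norm_conv f g x).tsum_le_tsum (fun _ => S.norm_mul_le _ _ _ _) (summable_at f g x)

theorem summable_norm_tsum (f g : L1 S) :
    Summable fun x => ‖∑' y, S.mul y (y⁻¹ * x) (f y) (g (y⁻¹ * x))‖ :=
  (summable_swap f g).prod.of_nonneg_of_le (fun _ => norm_nonneg _) (norm_conv_le f g)

/-- Convolution: `(f * g)(x) = ∑_y mul y (y⁻¹x) (f y) (g (y⁻¹x))`. -/
instance : Mul (L1 S) :=
  ⟨fun f g => mk (fun x => ∑' y, S.mul y (y⁻¹ * x) (f y) (g (y⁻¹ * x))) (summable_norm_tsum f g)⟩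

theorem mul_apply (f g : L1 S) (x : G) :
    (f * g) x = ∑' y, S.mul y (y⁻¹ * x) (f y) (g (y⁻¹ * x)) := rfl

theorem norm_mul_le' (f g : L1 S) : ‖f * g‖ ≤ ‖f‖ * ‖g‖ := by
  rw [norm_eq, ← tsum_prod]
  have hs := summable_swap f g
  have e : ∑' p : G × G, ‖f p.1‖ * ‖g (p.1⁻¹ * p.2)‖
      = ∑' p : G × G, ‖f p.2‖ * ‖g (p.2⁻¹ * p.1)‖ :=
    ((Equiv.prodComm G G).tsum_eq (fun p : G × G => ‖f p.1‖ * ‖g (p.1⁻¹ * p.2)‖)).symm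
  rw [e, hs.tsum_prod]
  exact (summable_norm (f * g)).tsum_le_tsum (norm_conv_le f g) hs.prod

theorem mul_add' (f g h : L1 S) : f * (g + h) = f * g + f * h := by
  refine ext fun x => ?_
  simp only [mul_apply, add_apply, map_add]
  exact (summable_conv f g x).tsum_add (summable_conv f h x)

theorem add_mul' (f g h : L1 S) : (f + g) * h = f * h + g * h := by
  refine ext fun x => ?_
  simp only [mul_apply, add_apply, map_add, _root_.add_apply]
  exact (summable_conv f h x).tsum_add (summable_conv g h x)

theorem smul_mul' (c : ℂ) (f g : L1 S) : (c • f) * g = c • (f * g) := by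
  refine ext fun x => ?_
  simp only [mul_apply, smul_apply, map_smul, _root_.smul_apply]
  exact tsum_const_smul'' c

theorem mul_smul' (c : ℂ) (f g : L1 S) : f * (c • g) = c • (f * g) := by
  refine ext fun x => ?_
  simp only [mul_apply, smul_apply, map_smul]
  exact tsum_const_smul'' c

theorem summable_triple (f g h : L1 S) (x : G) : Summable fun p : G × G =>
    S.mul p.2 (p.2⁻¹ * x) (S.mul p.1 (p.1⁻¹ * p.2) (f p.1) (g (p.1⁻¹ * p.2)))
      (h (p.2⁻¹ * x)) := by
  refine .of_norm_bounded (g := fun p : G × G => ‖f p.1‖ * ‖g (p.1⁻¹ * p.2)‖ * ‖h‖)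
    ((summable_prod f g).mul_right _) fun p => ?_
  refine (S.norm_mul_le _ _ _ _).trans ?_
  exact mul_le_mul (S.norm_mul_le _ _ _ _) (norm_apply_le h _) (norm_nonneg _) (by positivity)

theorem mul_assoc' (f g h : L1 S) : f * g * h = f * (g * h) := by
  refine ext fun x => ?_
  have hl : ∀ y, S.mul y (y⁻¹ * x) ((f * g) y) (h (y⁻¹ * x)) =
      ∑' z, S.mul y (y⁻¹ * x) (S.mul z (z⁻¹ * y) (f z) (g (z⁻¹ * y))) (h (y⁻¹ * x)) := by
    intro y
    exact ((S.mul y (y⁻¹ * x)).flip (h (y⁻¹ * x))).map_tsum (summable_conv f g y)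
  have hr : ∀ z, S.mul z (z⁻¹ * x) (f z) ((g * h) (z⁻¹ * x)) =
      ∑' y, S.mul y (y⁻¹ * x) (S.mul z (z⁻¹ * y) (f z) (g (z⁻¹ * y))) (h (y⁻¹ * x)) := by
    intro z
    have h1 := (S.mul z (z⁻¹ * x) (f z)).map_tsum (summable_conv g h (z⁻¹ * x))
    refine h1.trans ?_
    rw [← (Equiv.mulLeft z⁻¹).tsum_eq]
    refine tsum_congr fun y => ?_
    have h2 := S.mul_assoc z (z⁻¹ * y) (y⁻¹ * x) (f z) (g (z⁻¹ * y)) (h (y⁻¹ * x))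
    have e1 : (z⁻¹ * y)⁻¹ * (z⁻¹ * x) = y⁻¹ * x := by group
    have e2 : z⁻¹ * y * (y⁻¹ * x) = z⁻¹ * x := by group
    rw [mul_inv_cancel_left, e2] at h2
    simp only [Equiv.coe_mulLeft, e1]
    exact h2.symm
  rw [mul_apply, mul_apply, tsum_congr hl, tsum_congr hr]
  have ht := summable_triple f g h x
  exact ht.tsum_comm

instance : NonUnitalNormedRing (L1 S) :=
  { (inferInstance : NormedAddCommGroup (L1 S)) with
    mul := (· * ·)
    left_distrib := mul_add'
    right_distrib := add_mul'
    zero_mul := fun f => by simpa using smul_mul' 0 (0 : L1 S) f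
    mul_zero := fun f => by simpa using mul_smul' 0 f (0 : L1 S)
    mul_assoc := mul_assoc'
    norm_mul_le := norm_mul_le' }

instance : IsScalarTower ℂ (L1 S) (L1 S) := ⟨smul_mul'⟩

instance : SMulCommClass ℂ (L1 S) (L1 S) := ⟨fun c f g => (mul_smul' c f g).symm⟩

theorem summable_norm_star (f : L1 S) : Summable fun x => ‖S.inv x (f x⁻¹)‖ := by
  simp only [S.norm_inv]
  exact (Equiv.inv G).summable_iff.2 (summable_norm f)

/-- Involution: `f^*(x) = inv x (f x⁻¹)`. -/
instance : Star (L1 S) := ⟨fun f => mk (fun x => S.inv x (f x⁻¹)) (summable_norm_star f)⟩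

theorem star_apply (f : L1 S) (x : G) : (star f) x = S.inv x (f x⁻¹) := rfl

theorem star_mul' (f g : L1 S) : star (f * g) = star g * star f := by
  refine ext fun x => ?_
  rw [star_apply, mul_apply, (S.inv x).map_tsum (summable_conv f g x⁻¹), mul_apply,
    ← (Equiv.mulLeft x).tsum_eq fun z => S.mul z (z⁻¹ * x) (star g z) (star f (z⁻¹ * x))]
  refine tsum_congr fun y => ?_
  have h := S.inv_mul y (y⁻¹ * x⁻¹) (f y) (g (y⁻¹ * x⁻¹))
  have e1 : (y⁻¹ * x⁻¹)⁻¹ = x * y := by group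
  have e2 : (x * y)⁻¹ * x = y⁻¹ := by group
  rw [mul_inv_cancel_left, inv_inv, e1] at h
  simp only [Equiv.coe_mulLeft, star_apply, e2, inv_inv]
  rw [mul_inv_rev]
  exact h

instance : StarRing (L1 S) where
  star_involutive f := ext fun x => by
    simp only [star_apply]
    rw [S.inv_inv, inv_inv]
  star_mul := star_mul'
  star_add f g := ext fun x => by simp [star_apply]

instance : StarModule ℂ (L1 S) where
  star_smul c f := ext fun x => by simp [star_apply]

instance : NormedStarGroup (L1 S) where
  norm_star_le f := by
    rw [norm_eq, norm_eq]
    simp only [star_apply, S.norm_inv]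
    exact ((Equiv.inv G).tsum_eq fun x => ‖f x‖).le

end L1
end Fibers
/-! ### Rigidly symmetric groups -/

section Symmetric

/-- The plain convolution structure on `ℓ¹(G; B)`, i.e. that of the projective tensor product
of `ℓ¹(G)` and `B`: `(f * g)(x) = ∑_y f(y) g(y⁻¹x)` and `f^*(x) = f(x⁻¹)^*`. -/
def plainFibers (G : Type u) [Group G] (B : Type v) [NonUnitalCStarAlgebra B] :
    FiberStructure G B where
  mul _ _ := ContinuousLinearMap.mul ℂ B
  inv _ := (starL ℂ : B ≃L⋆[ℂ] B).toContinuousLinearMap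
  norm_mul_le _ _ a b := norm_mul_le a b
  mul_assoc _ _ _ a b c := mul_assoc a b c
  norm_inv _ a := norm_star a
  inv_inv _ a := star_star a
  inv_mul _ _ a b := star_mul a b

theorem plain_mul_apply {G : Type u} [Group G] {B : Type v} [NonUnitalCStarAlgebra B]
    (f g : L1 (plainFibers G B)) (x : G) : (f * g) x = ∑' y, f y * g (y⁻¹ * x) := rfl

theorem plain_star_apply {G : Type u} [Group G] {B : Type v} [NonUnitalCStarAlgebra B]
    (f : L1 (plainFibers G B)) (x : G) : (star f) x = star (f x⁻¹) := rfl

/-- A (possibly non-unital) complex `*`-algebra is symmetric if `b^* b` has non-negative spectrum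
for all `b`. The spectrum of an element of a non-unital algebra is the one in the unitization,
which is `quasispectrum`; for a unital algebra this adds at most the point `0`. -/
def IsSymmetric (𝔅 : Type u) [NonUnitalRing 𝔅] [Module ℂ 𝔅] [Star 𝔅] : Prop :=
  ∀ b : 𝔅, ∀ z ∈ quasispectrum ℂ (star b * b), 0 ≤ z.re ∧ z.im = 0

/-- A discrete group `G` is rigidly symmetric if `ℓ¹(G; B)`, which is the projective tensor product
of `ℓ¹(G)` and `B`, is symmetric for every `C^*`-algebra `B`. -/
def RigidlySymmetric (G : Type u) [Group G] : Prop :=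
  ∀ (B : Type v) [NonUnitalCStarAlgebra B], IsSymmetric (L1 (plainFibers G B))

end Symmetric

/-! ### Twisted actions and the twisted `ℓ¹`-algebra -/

section Twisted

/-- A twisted action `(α, ω)` of the discrete group `G` on the unital `C^*`-algebra `A`. -/
structure TwistedAction (G : Type u) [Group G] (A : Type v) [CStarAlgebra A] where
  α : G → A ≃⋆ₐ[ℂ] A
  ω : G → G → unitary A
  α_comp : ∀ x y a, α x (α y a) = (ω x y : A) * α (x * y) a * star (ω x y : A)
  cocycle : ∀ x y z, (ω x y : A) * (ω (x * y) z : A) = α x (ω y z : A) * (ω x (y * z) : A)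
  ω_one_right : ∀ x, ω x 1 = 1
  ω_one_left : ∀ x, ω 1 x = 1

namespace TwistedAction

variable {G : Type u} [Group G] {A : Type v} [CStarAlgebra A] (S : TwistedAction G A)

theorem star_ω_mul (x y : G) : star (S.ω x y : A) * (S.ω x y : A) = 1 :=
  Unitary.coe_star_mul_self _

theorem ω_mul_star (x y : G) : (S.ω x y : A) * star (S.ω x y : A) = 1 :=
  Unitary.coe_mul_star_self _

/-- The convolution structure of a twisted action; see `twisted_mul_apply` and
`twisted_star_apply` for the resulting operations. -/
def fibers : FiberStructure G A where
  mul x y := LinearMap.mkContinuous₂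
    (LinearMap.mk₂ ℂ (fun a b : A => a * S.α x b * (S.ω x y : A))
      (fun a a' b => by simp [add_mul]) (fun c a b => by simp)
      (fun a b b' => by simp [mul_add, add_mul]) (fun c a b => by simp)) 1
    (fun a b => by
      simp only [LinearMap.mk₂_apply, one_mul]
      rw [CStarRing.norm_mul_coe_unitary]
      exact (norm_mul_le _ _).trans_eq (by rw [StarAlgEquiv.norm_map]))
  inv x := LinearMap.mkContinuous
    { toFun := fun a : A => star (S.ω x x⁻¹ : A) * star (S.α x a)
      map_add' := fun a b => by simp [mul_add]
      map_smul' := fun c a => by simp } 1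
    (fun a => by
      change ‖star (S.ω x x⁻¹ : A) * star (S.α x a)‖ ≤ 1 * ‖a‖
      rw [one_mul, ← Unitary.coe_star, CStarRing.norm_coe_unitary_mul, norm_star,
        StarAlgEquiv.norm_map])
  norm_mul_le x y a b := by
    change ‖a * S.α x b * (S.ω x y : A)‖ ≤ _
    rw [CStarRing.norm_mul_coe_unitary]
    exact (norm_mul_le _ _).trans_eq (by rw [StarAlgEquiv.norm_map])
  mul_assoc x y z a b c := by
    change a * S.α x b * (S.ω x y : A) * S.α (x * y) c * (S.ω (x * y) z : A) =
      a * S.α x (b * S.α y c * (S.ω y z : A)) * (S.ω x (y * z) : A)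
    simp only [map_mul, S.α_comp, mul_assoc]
    rw [← S.cocycle, ← mul_assoc (star (S.ω x y : A)), S.star_ω_mul, one_mul]
  norm_inv x a := by
    change ‖star (S.ω x x⁻¹ : A) * star (S.α x a)‖ = ‖a‖
    rw [← Unitary.coe_star, CStarRing.norm_coe_unitary_mul, norm_star, StarAlgEquiv.norm_map]
  inv_inv x a := by
    change star (S.ω x x⁻¹ : A) *
      star (S.α x (star (S.ω x⁻¹ x⁻¹⁻¹ : A) * star (S.α x⁻¹ a))) = a
    have h1 : S.α 1 a = a := by
      apply (S.α 1).injective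
      simpa [S.ω_one_left] using S.α_comp 1 1 a
    have h2 : S.α x (S.ω x⁻¹ x : A) = (S.ω x x⁻¹ : A) := by
      simpa [S.ω_one_left, S.ω_one_right] using (S.cocycle x x⁻¹ x).symm
    rw [inv_inv, ← map_star (S.α x), star_mul, star_star, star_star, map_mul, S.α_comp, h2,
      mul_inv_cancel, h1, mul_assoc _ (star _), S.star_ω_mul, mul_one, ← mul_assoc, S.star_ω_mul,
      one_mul]
  inv_mul x y a b := by
    change star (S.ω (x * y)⁻¹ (x * y)⁻¹⁻¹ : A) *
        star (S.α (x * y)⁻¹ (a * S.α x b * (S.ω x y : A))) =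
      star (S.ω y⁻¹ y⁻¹⁻¹ : A) * star (S.α y⁻¹ b) *
        S.α y⁻¹ (star (S.ω x⁻¹ x⁻¹⁻¹ : A) * star (S.α x⁻¹ a)) * (S.ω y⁻¹ x⁻¹ : A)
    have e1 : (x * y)⁻¹ * x = y⁻¹ := by group
    have e2 : y⁻¹ * x⁻¹ = (x * y)⁻¹ := by group
    have h1 := S.cocycle (x * y)⁻¹ x y
    have h2 := S.cocycle y⁻¹ x⁻¹ x
    rw [e1] at h1
    rw [e2, inv_mul_cancel, S.ω_one_right, OneMemClass.coe_one, mul_one] at h2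
    simp only [inv_inv, map_mul, S.α_comp, map_star, star_mul, star_star, e1, e2, ← h2]
    have h3 := congrArg star h1
    simp only [star_mul] at h3
    have k : ∀ (c : A) (x y : G), c * star (S.ω x y : A) * (S.ω x y : A) = c := by
      intro c x y
      rw [mul_assoc, S.star_ω_mul, mul_one]
    simp only [← mul_assoc, ← h3, k]

/-- The `ℓ¹`-twisted crossed product `ℓ¹_{α,ω}(G; A)`. -/
abbrev TwistedL1 : Type (max u v) := L1 S.fibers

theorem twisted_mul_apply (f g : S.TwistedL1) (x : G) :
    (f * g) x = ∑' y, f y * S.α y (g (y⁻¹ * x)) * (S.ω y (y⁻¹ * x) : A) := rfl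

theorem twisted_star_apply (f : S.TwistedL1) (x : G) :
    (star f) x = star (S.ω x x⁻¹ : A) * star (S.α x (f x⁻¹)) := rfl

end TwistedAction

end Twisted

/-! ### The enveloping `C^*`-algebra -/

section Enveloping

variable (𝔅 : Type u) [NonUnitalNormedRing 𝔅] [StarRing 𝔅] [NormedStarGroup 𝔅] [CompleteSpace 𝔅]
  [NormedSpace ℂ 𝔅] [IsScalarTower ℂ 𝔅 𝔅] [SMulCommClass ℂ 𝔅 𝔅] [StarModule ℂ 𝔅]

/-- A `*`-representation of the Banach `*`-algebra `𝔅` on a Hilbert space. -/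
structure HilbertRep : Type (u + 1) where
  H : Type u
  [normed : NormedAddCommGroup H]
  [inner : InnerProductSpace ℂ H]
  [complete : CompleteSpace H]
  toHom : 𝔅 →⋆ₙₐ[ℂ] (H →L[ℂ] H)

attribute [instance] HilbertRep.normed HilbertRep.inner HilbertRep.complete


variable {𝔅} in
/-- A `*`-homomorphism from a Banach `*`-algebra to a `C^*`-algebra is contractive. -/
theorem norm_hom_le {D : Type*} [NonUnitalCStarAlgebra D] (φ : 𝔅 →⋆ₙₐ[ℂ] D) (b : 𝔅) :
    ‖φ b‖ ≤ ‖b‖ := by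
  have key : ∀ h : 𝔅, IsSelfAdjoint h → ‖φ h‖ ≤ ‖h‖ := by
    intro h hh
    have hs : IsSelfAdjoint (φ h : Unitization ℂ D) := (hh.map φ).inr ℂ
    have hr : spectralRadius ℂ (φ h : Unitization ℂ D) ≤ (‖h‖₊ : ℝ≥0∞) := by
      refine iSup₂_le fun k hk => ?_
      rw [← Unitization.quasispectrum_eq_spectrum_inr ℂ] at hk
      have hk' := NonUnitalAlgHom.quasispectrum_apply_subset φ h hk
      rw [Unitization.quasispectrum_eq_spectrum_inr ℂ,
        ← AlgEquiv.spectrum_eq (WithLp.unitizationAlgEquiv (𝕜 := ℂ) (A := 𝔅) ℂ).symm] at hk'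
      have h2 := spectrum.norm_le_norm_mul_of_mem hk'
      have h3 : ‖(1 : WithLp 1 (Unitization ℂ 𝔅))‖ = 1 := by
        rw [WithLp.unitization_norm_def]
        change ‖(1 : ℂ)‖ + ‖(0 : 𝔅)‖ = 1
        simp
      have h4 : ‖(WithLp.unitizationAlgEquiv (𝕜 := ℂ) (A := 𝔅) ℂ).symm (h : Unitization ℂ 𝔅)‖
          = ‖h‖ := WithLp.unitization_norm_inr h
      rw [h3, h4, mul_one] at h2
      exact_mod_cast h2
    rw [hs.spectralRadius_eq_nnnorm, Unitization.nnnorm_inr] at hr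
    exact_mod_cast hr
  have h1 := key (star b * b) (.star_mul_self b)
  rw [map_mul, map_star, CStarRing.norm_star_mul_self] at h1
  have h2 : ‖star b * b‖ ≤ ‖b‖ * ‖b‖ := (norm_mul_le _ _).trans_eq (by rw [norm_star])
  exact le_of_sq_le_sq (by nlinarith) (norm_nonneg _)

variable {𝔅} in
theorem memlp_rep (b : 𝔅) :
    Memℓp (E := fun π : HilbertRep 𝔅 => π.H →L[ℂ] π.H) (fun π => π.toHom b) ∞ :=
  memℓp_infty ⟨‖b‖, by rintro _ ⟨π, rfl⟩; exact norm_hom_le π.toHom b⟩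

/-- The `C^*`-algebra of bounded families of operators `T_π`, one on each representation
space `π` of `𝔅`, with the supremum norm. -/
def RepProduct : Type (u + 1) := lp (fun π : HilbertRep 𝔅 => π.H →L[ℂ] π.H) ∞

instance : NonUnitalCStarAlgebra (RepProduct 𝔅) :=
  inferInstanceAs (NonUnitalCStarAlgebra (lp (fun π : HilbertRep 𝔅 => π.H →L[ℂ] π.H) ∞))

/-- The universal representation `b ↦ (π b)_π` of `𝔅`. -/
def universalRep : 𝔅 →⋆ₙₐ[ℂ] RepProduct 𝔅 where
  toFun b := ⟨fun π => π.toHom b, memlp_rep b⟩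
  map_smul' c b := lp.ext (funext fun π => map_smul π.toHom c b)
  map_zero' := lp.ext (funext fun π => map_zero π.toHom)
  map_add' a b := lp.ext (funext fun π => map_add π.toHom a b)
  map_mul' a b := lp.ext (funext fun π => map_mul π.toHom a b)
  map_star' b := lp.ext (funext fun π => map_star π.toHom b)

/-- The enveloping `C^*`-algebra of the Banach `*`-algebra `𝔅`: the norm closure of the image of
`𝔅` under its universal representation. So it is the (Hausdorff) completion of `𝔅` in the
`C^*`-seminorm `b ↦ sup ‖π b‖`, where `π` runs over all `*`-representations. -/
def Enveloping : Type (u + 1) :=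
  (NonUnitalStarAlgHom.range (universalRep 𝔅)).topologicalClosure

instance : NonUnitalCStarAlgebra (Enveloping 𝔅) :=
  NonUnitalStarSubalgebra.nonUnitalCStarAlgebra
    (NonUnitalStarAlgHom.range (universalRep 𝔅)).topologicalClosure
    (h_closed := NonUnitalStarSubalgebra.isClosed_topologicalClosure _)

/-- The canonical `*`-homomorphism of `𝔅` into its enveloping `C^*`-algebra. -/
def toEnveloping : 𝔅 →⋆ₙₐ[ℂ] Enveloping 𝔅 where
  toFun b := ⟨universalRep 𝔅 b, subset_closure ⟨b, rfl⟩⟩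
  map_smul' c b := Subtype.ext (map_smul (universalRep 𝔅) c b)
  map_zero' := Subtype.ext (map_zero (universalRep 𝔅))
  map_add' a b := Subtype.ext (map_add (universalRep 𝔅) a b)
  map_mul' a b := Subtype.ext (map_mul (universalRep 𝔅) a b)
  map_star' b := Subtype.ext (map_star (universalRep 𝔅) b)

end Enveloping

/-! ### Twisted crossed products and Fredholm inverse closedness -/

section Crossed

namespace TwistedAction

variable {G : Type u} [Group G] {A : Type v} [CStarAlgebra A] (S : TwistedAction G A)

/-- The twisted crossed product `C^*`-algebra `A ⋊ G`. -/
abbrev CrossedProduct : Type (max u v + 1) := Enveloping S.TwistedL1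

/-- The canonical map `ℓ¹_{α,ω}(G; A) → A ⋊ G`. -/
abbrev toCrossedProduct : S.TwistedL1 →⋆ₙₐ[ℂ] S.CrossedProduct := toEnveloping S.TwistedL1

/-- For an invariant closed ideal `J` of `A`, the ideal `J ⋊ G` of `A ⋊ G`:
the closure of (the image of) `ℓ¹_{α,ω}(G; J)`. -/
def crossedIdeal (J : Ideal A) : Set S.CrossedProduct :=
  closure (S.toCrossedProduct '' {f | ∀ x, f x ∈ J})

end TwistedAction

variable {H : Type w} [NormedAddCommGroup H] [InnerProductSpace ℂ H] [CompleteSpace H]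

/-- On a Hilbert space, Mathlib's Fredholm operators are the operators with closed range and
finite-dimensional kernel such that the adjoint has a finite-dimensional kernel. -/
theorem isFredholm_iff (T : H →L[ℂ] H) :
    T.IsFredholm ↔ IsClosed (Set.range T) ∧ FiniteDimensional ℂ T.ker ∧
      FiniteDimensional ℂ (ContinuousLinearMap.adjoint T).ker := by
  have key : IsClosed (Set.range T) →
      (FiniteDimensional ℂ (ContinuousLinearMap.adjoint T).ker ↔ T.range.CoFG) := by
    intro hc
    have : CompleteSpace T.range := hc.completeSpace_coe
    rw [← ContinuousLinearMap.orthogonal_range]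
    let e := Submodule.quotientEquivOfIsCompl _ _ (Submodule.isCompl_orthogonal T.range)
    exact (Module.Finite.equiv_iff e).symm
  constructor
  · intro h
    exact ⟨h.isClosed_range, h.finite_ker, (key h.isClosed_range).2 h.finite_coker⟩
  · rintro ⟨hc, hk, ha⟩
    have : CompleteSpace T.range := hc.completeSpace_coe
    refine ⟨?_, hc, hk, (key hc).1 ha, .of_finiteDimensional _⟩
    have hq : Topology.IsQuotientMap T.rangeRestrict :=
      T.rangeRestrict.isQuotientMap (LinearMap.surjective_rangeRestrict _)
    exact Topology.isStrictMap_iff_isQuotientMap_rangeFactorization.2 hq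

/-- A `*`-algebra `F` of bounded operators on `H` is Fredholm inverse closed if
every Fredholm operator in `F` has an inverse modulo compact operators that lies in `F`. -/
def FredholmInverseClosed (F : NonUnitalStarSubalgebra ℂ (H →L[ℂ] H)) : Prop :=
  ∀ T ∈ F, T.IsFredholm → ∃ S ∈ F, ∃ K L : H →L[ℂ] H,
    IsCompactOperator K ∧ IsCompactOperator L ∧ S * T = 1 + K ∧ T * S = 1 + L

end Crossed

end TwistedCrossed

end

noncomputable section

namespace TwistedCrossed

/-! ### Square roots in Banach algebras -/

section Sqrt

open Filter Topology

/-! Write `T = Pi (S.toCrossedProduct f)`. By Atkinson's theorem `T` is invertible modulo compact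
operators, and the task is to find an inverse modulo compacts inside the image of the `ℓ¹`-algebra.
This rests on two facts.

Symmetry. Let `ρ` map the twisted `ℓ¹`-algebra into a `C^*`-algebra `B`, with kernel inside that of
the map to the crossed product. Then `f ↦ (x ↦ ρ (single x (f x)))` is a `*`-homomorphism `diagonal`
into the plain algebra `ℓ¹(G; B)`, where rigid symmetry applies. Values of `diagonal` have preimages
of controlled norm, so its range is closed. Passing to a closed subalgebra enlarges a spectrum only
by filling holes, and non-negativity survives. Hence `z - star f * f` is invertible modulo the
kernel of `toCrossedProduct` for every `z` off `[0, ∞)` (`exists_inverse_mod_ker`).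

Detection by representations. Let `N` be the closed `*`-ideal of elements with compact image. The
quotient by `N` inherits the positivity of squares. If `f` had no left inverse modulo `N`, then
`star f * f` would be singular there. The Riesz extension theorem would give a positive functional
vanishing on it, and GNS a representation `π` killing `N`, with a nonzero vector `ξ` such that `π(f)
ξ = 0` (`ClosedStarIdeal.exists_hilbertRep`). But `V T = 1 + K` gives `1 ≤ 2‖V‖² T*T + 2 K*K`. Here
`K*K` is the image of an element of `J ⋊ G`, which the extension of `π` to the crossed product
kills. As `Pi` is isometric, the inequality passes to `π` as a norm estimate, and evaluation at `ξ`
contradicts it (`exists_left_inverse_mod_compact`).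

A left inverse modulo compacts is also a right one, because `T` is invertible modulo compacts. -/

theorem abs_choose_half_le_one (n : ℕ) : |Ring.choose (1 / 2 : ℝ) n| ≤ 1 := by
  induction n with
  | zero => simp
  | succ n ih =>
    -- The recursion `(n + 1) c (n + 1) = c n (1/2 - n)`, where `|1/2 - n| ≤ n + 1`.
    have h := Ring.choose_smul_choose (1 / 2 : ℝ) (Nat.le_succ n)
    simp only [Nat.succ_eq_add_one, Nat.add_sub_cancel_left, Ring.choose_one_right,
      Nat.choose_succ_self_right, nsmul_eq_mul, Nat.cast_add, Nat.cast_one] at h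
    have hn : (0 : ℝ) < n + 1 := by positivity
    have h2 : |(n + 1 : ℝ) * Ring.choose (1 / 2 : ℝ) (n + 1)| ≤ (n + 1 : ℝ) * 1 := by
      rw [h, abs_mul, mul_comm]
      refine mul_le_mul ?_ ih (abs_nonneg _) hn.le
      rw [abs_le]
      constructor <;> linarith
    rw [abs_mul, abs_of_pos hn] at h2
    exact le_of_mul_le_mul_left h2 hn

variable {Q : Type u} [NormedRing Q] [NormedAlgebra ℂ Q] [CompleteSpace Q]

/-- The powers of an element of spectral radius less than one are absolutely summable. -/
theorem summable_norm_pow_of_spectralRadius_lt_one {x : Q} (hx : spectralRadius ℂ x < 1) :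
    Summable fun n => ‖x ^ n‖ := by
  obtain ⟨q, hq, hq1⟩ := exists_between hx
  lift q to NNReal using (hq1.trans ENNReal.one_lt_top).ne
  have hq1' : (q : ℝ) < 1 := by exact_mod_cast hq1
  -- Gelfand's formula: eventually `‖x ^ n‖ ≤ q ^ n`, with `q` strictly between the spectral radius
  -- and `1`.
  have h1 := (spectrum.pow_nnnorm_pow_one_div_tendsto_nhds_spectralRadius x).eventually
    (gt_mem_nhds hq)
  refine .of_norm_bounded_eventually_nat (summable_geometric_of_lt_one q.2 hq1') ?_
  filter_upwards [h1, eventually_gt_atTop 0] with n hn hn0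
  have hn' : (0 : ℝ) < n := by exact_mod_cast hn0
  have h2 := ENNReal.rpow_le_rpow hn.le hn'.le
  rw [← ENNReal.rpow_mul, one_div_mul_cancel hn'.ne', ENNReal.rpow_one, ENNReal.rpow_natCast] at h2
  rw [norm_norm]
  exact_mod_cast h2

/-- The binomial series provides a square root of `1 + x` if `x` has spectral radius less
than one. -/
theorem exists_mul_self_eq_one_add [StarRing Q] [StarModule ℂ Q] [NormedStarGroup Q] {x : Q}
    (hx : spectralRadius ℂ x < 1) (hs : IsSelfAdjoint x) :
    ∃ y : Q, IsSelfAdjoint y ∧ y * y = 1 + x := by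
  set c : ℕ → ℝ := fun n => Ring.choose (1 / 2 : ℝ) n with hc
  have hsum : Summable fun n => ‖c n • x ^ n‖ := by
    refine (summable_norm_pow_of_spectralRadius_lt_one hx).of_nonneg_of_le
      (fun _ => norm_nonneg _) fun n => ?_
    rw [norm_smul, Real.norm_eq_abs]
    exact mul_le_of_le_one_left (norm_nonneg _) (abs_choose_half_le_one n)
  refine ⟨∑' n, c n • x ^ n, ?_, ?_⟩
  · rw [IsSelfAdjoint, tsum_star]
    refine tsum_congr fun n => ?_
    rw [star_smul, star_pow, hs.star_eq, star_trivial]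
  · rw [tsum_mul_tsum_eq_tsum_sum_antidiagonal_of_summable_norm hsum hsum]
    have h : ∀ n, ∑ kl ∈ Finset.HasAntidiagonal.antidiagonal n, c kl.1 • x ^ kl.1 * c kl.2 • x ^ kl.2 =
        (Nat.choose 1 n : ℝ) • x ^ n := by
      intro n
      -- Chu–Vandermonde for `1/2 + 1/2 = 1`: the Cauchy square has coefficients `Nat.choose 1 n`,
      -- so only the terms `n = 0, 1` survive.
      have h1 := Ring.add_choose_eq n (Commute.all (1 / 2 : ℝ) (1 / 2))
      rw [add_halves, ← Nat.cast_one, Ring.choose_natCast] at h1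
      rw [h1, Finset.sum_smul]
      refine Finset.sum_congr rfl fun kl hkl => ?_
      rw [smul_mul_smul_comm, ← pow_add, Finset.HasAntidiagonal.mem_antidiagonal.1 hkl]
      simp [hc]
    rw [tsum_congr h, tsum_eq_sum (s := {0, 1})]
    · simp
    · intro n hn
      have : 1 < n := by
        simp at hn
        omega
      rw [Nat.choose_eq_zero_of_lt this]
      simp

end Sqrt

/-! ### Positive elements of symmetric Banach `*`-algebras -/

section Positive

variable {Q : Type u} [NormedRing Q] [NormedAlgebra ℂ Q] [StarRing Q]

/-- Self-adjoint elements with non-negative spectrum. -/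
def IsPos (h : Q) : Prop := IsSelfAdjoint h ∧ ∀ z ∈ spectrum ℂ h, 0 ≤ z.re ∧ z.im = 0

/-- Self-adjoint elements with spectrum in the open half-line `(0, ∞)`. -/
def IsStrictPos (h : Q) : Prop := IsSelfAdjoint h ∧ ∀ z ∈ spectrum ℂ h, 0 < z.re ∧ z.im = 0

variable (Q) in
/-- The spectra of the elements `star x * x` are non-negative. -/
def HasPosSquares : Prop := ∀ x : Q, IsPos (star x * x)

theorem mem_spectrum_add_real {h : Q} {t : ℝ} {z : ℂ} :
    z ∈ spectrum ℂ (h + algebraMap ℝ Q t) ↔ z - t ∈ spectrum ℂ h := by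
  rw [spectrum.mem_iff, spectrum.mem_iff, IsScalarTower.algebraMap_apply ℝ ℂ Q, map_sub]
  have : algebraMap ℂ Q z - (h + algebraMap ℂ Q (algebraMap ℝ ℂ t)) =
    algebraMap ℂ Q z - algebraMap ℂ Q (t : ℂ) - h := by
      rw [Complex.coe_algebraMap]; abel
  rw [this]

theorem mem_spectrum_real_smul {h : Q} {t : ℝ} (ht : t ≠ 0) {z : ℂ} :
    z ∈ spectrum ℂ (t • h) ↔ (t : ℂ)⁻¹ * z ∈ spectrum ℂ h := by
  have h1 : t • h = (Units.mk0 (t : ℂ) (by exact_mod_cast ht)) • h := by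
    rw [Units.smul_mk0, Complex.coe_smul]
  rw [h1, spectrum.unit_smul_eq_smul, Set.mem_smul_set_iff_inv_smul_mem]
  simp [Units.smul_def]

section
variable [StarModule ℂ Q]

theorem isSelfAdjoint_algebraMap_real (t : ℝ) : IsSelfAdjoint (algebraMap ℝ Q t) :=
  .algebraMap Q (star_trivial t)

theorem IsPos.add_real {h : Q} (hh : IsPos h) {t : ℝ} (ht : 0 < t) :
    IsStrictPos (h + algebraMap ℝ Q t) := by
  refine ⟨hh.1.add (isSelfAdjoint_algebraMap_real t), fun z hz => ?_⟩
  have := hh.2 _ (mem_spectrum_add_real.1 hz)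
  simp only [Complex.sub_re, Complex.ofReal_re, Complex.sub_im, Complex.ofReal_im, sub_zero] at this
  exact ⟨by linarith, this.2⟩

theorem IsPos.smul {h : Q} (hh : IsPos h) {t : ℝ} (ht : 0 ≤ t) : IsPos (t • h) := by
  refine ⟨(IsSelfAdjoint.all t).smul hh.1, fun z hz => ?_⟩
  rcases ht.eq_or_lt with rfl | ht
  · rw [zero_smul] at hz
    have : Nontrivial Q := by
      by_contra hn
      rw [not_nontrivial_iff_subsingleton] at hn
      exact hz (isUnit_of_subsingleton _)
    rw [spectrum.zero_eq, Set.mem_singleton_iff] at hz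
    simp [hz]
  · have := hh.2 _ ((mem_spectrum_real_smul ht.ne').1 hz)
    rw [← Complex.ofReal_inv, Complex.re_ofReal_mul, Complex.im_ofReal_mul] at this
    refine ⟨?_, by simpa [ht.ne'] using this.2⟩
    have := mul_nonneg ht.le this.1
    rwa [mul_inv_cancel_left₀ ht.ne'] at this

variable [CompleteSpace Q] [NormedStarGroup Q]

/-- Rescaling moves the spectrum into `(0, 1)`, so `M⁻¹ h - 1` has spectral radius less than one and
the binomial series applies. Strict positivity is needed to stay away from `-1`. -/
theorem IsStrictPos.exists_mul_self_eq [Nontrivial Q] {h : Q} (hh : IsStrictPos h) :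
    ∃ y : Q, IsSelfAdjoint y ∧ y * y = h := by
  -- The norm of the unit is not assumed to be `1`, so the spectrum is bounded by `‖h‖ * ‖1‖`;
  -- adding `1` makes the bound strict.
  set M : ℝ := ‖h‖ * ‖(1 : Q)‖ + 1 with hM
  have hM0 : 0 < M := by positivity
  set x : Q := M⁻¹ • h + algebraMap ℝ Q (-1) with hx
  have hxs : IsSelfAdjoint x :=
    ((IsSelfAdjoint.all _).smul hh.1).add (isSelfAdjoint_algebraMap_real _)
  have hxr : spectralRadius ℂ x < 1 := by
    rw [← ENNReal.coe_one]
    refine spectrum.spectralRadius_lt_of_forall_lt x fun z hz => ?_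
    rw [hx, mem_spectrum_add_real, mem_spectrum_real_smul (inv_ne_zero hM0.ne')] at hz
    have h1 := hh.2 _ hz
    have h2 := spectrum.norm_le_norm_mul_of_mem hz
    have h2' := (Complex.re_le_norm _).trans h2
    rw [← Complex.ofReal_inv, inv_inv, Complex.re_ofReal_mul] at h2'
    rw [← Complex.ofReal_inv, inv_inv, Complex.re_ofReal_mul, Complex.im_ofReal_mul] at h1
    simp only [Complex.sub_re, Complex.ofReal_re, Complex.sub_im, Complex.ofReal_im, sub_zero,
      mul_eq_zero, hM0.ne', false_or, sub_neg_eq_add] at h1 h2'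
    have h3 : 0 < z.re + 1 := pos_of_mul_pos_right h1.1 hM0.le
    have h4 : z.re + 1 < 1 := by
      have : M * (z.re + 1) < M * 1 := by linarith
      exact lt_of_mul_lt_mul_left this hM0.le
    rw [← NNReal.coe_lt_coe, coe_nnnorm, NNReal.coe_one]
    have hz' : z = (z.re : ℂ) := Complex.ext rfl (by simp [h1.2])
    rw [hz', Complex.norm_real, Real.norm_eq_abs, abs_lt]
    constructor <;> linarith
  obtain ⟨y, hy, hyy⟩ := exists_mul_self_eq_one_add hxr hxs
  refine ⟨Real.sqrt M • y, (IsSelfAdjoint.all _).smul hy, ?_⟩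
  rw [smul_mul_smul_comm, Real.mul_self_sqrt hM0.le, hyy, hx]
  simp [smul_smul, hM0.ne']

theorem IsStrictPos.isUnit {h : Q} (hh : IsStrictPos h) : IsUnit h := by
  have : (0 : ℂ) ∉ spectrum ℂ h := fun h0 => by simpa using (hh.2 0 h0).1
  simpa [spectrum.zero_mem_iff] using this

/-- By spectral mapping `z ^ 2` lies in the spectrum of `star h * h`, so it is a non-negative real,
which forces `z` to be real. -/
theorem HasPosSquares.im_eq_zero [Nontrivial Q] (hQ : HasPosSquares Q) {h : Q}
    (hh : IsSelfAdjoint h) {z : ℂ} (hz : z ∈ spectrum ℂ h) : z.im = 0 := by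
  have h1 : z ^ 2 ∈ spectrum ℂ (h ^ 2) := by
    rw [spectrum.map_pow]
    exact ⟨z, hz, rfl⟩
  have h2 := (hQ h).2 (z ^ 2) (by rwa [hh.star_eq, ← sq])
  simp only [sq, Complex.mul_re, Complex.mul_im] at h2
  by_contra h0
  have h3 : z.re = 0 := by
    have : z.re * z.im = 0 := by linarith [h2.2]
    simpa [h0] using this
  have h4 := mul_self_pos.2 h0
  rw [h3] at h2
  linarith [h2.1]

/-- With `h = y²`, `k = x²` and `a = x y⁻¹`, one has `h + k = y (1 + star a * a) y`, a product of
units. -/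
theorem HasPosSquares.isUnit_add [Nontrivial Q] (hQ : HasPosSquares Q) {h k : Q}
    (hh : IsStrictPos h) (hk : IsStrictPos k) : IsUnit (h + k) := by
  obtain ⟨y, hy, rfl⟩ := hh.exists_mul_self_eq
  obtain ⟨x, hx, rfl⟩ := hk.exists_mul_self_eq
  obtain ⟨y, rfl⟩ := (((Commute.refl y).isUnit_mul_iff).1 hh.isUnit).1
  set a : Q := x * ↑y⁻¹ with ha
  have h1 := ((hQ a).add_real one_pos).isUnit
  have h2 : star (↑y⁻¹ : Q) * y = 1 := by
    conv_lhs => rw [← hy.star_eq]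
    rw [← star_mul, y.mul_inv, star_one]
  have h3 : (y : Q) * star (↑y⁻¹ : Q) = 1 := by
    conv_lhs => rw [← hy.star_eq]
    rw [← star_mul, y.inv_mul, star_one]
  have : (y : Q) * y + x * x = y * (star a * a + algebraMap ℝ Q 1) * y := by
    rw [ha, star_mul, hx.star_eq, map_one, mul_add, add_mul, mul_one, add_comm]
    congr 1
    calc x * x = 1 * x * (x * 1) := by simp
      _ = (y * star (↑y⁻¹ : Q)) * x * (x * (↑y⁻¹ * ↑y)) := by rw [h3, y.inv_mul]
      _ = _ := by simp only [mul_assoc]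
  rw [this]
  exact (y.isUnit.mul h1).mul y.isUnit

/-- For real `z < 0` the element `h + k - z` is the sum of `h - z/2` and `k - z/2`, both strictly
positive, hence a unit. This makes the positive elements a convex cone, as the extension of
functionals requires. -/
theorem HasPosSquares.isPos_add [Nontrivial Q] (hQ : HasPosSquares Q) {h k : Q}
    (hh : IsPos h) (hk : IsPos k) : IsPos (h + k) := by
  refine ⟨hh.1.add hk.1, fun z hz => ?_⟩
  have him := hQ.im_eq_zero (hh.1.add hk.1) hz
  refine ⟨?_, him⟩
  by_contra! hneg
  have ht : 0 < -z.re / 2 := by linarith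
  have hu := hQ.isUnit_add (hh.add_real ht) (hk.add_real ht)
  refine hz ?_
  have hz' : z = ((z.re : ℝ) : ℂ) := Complex.ext rfl (by simp [him])
  have : algebraMap ℂ Q z = algebraMap ℝ Q z.re := by
    rw [IsScalarTower.algebraMap_apply ℝ ℂ Q, Complex.coe_algebraMap, ← hz']
  rw [spectrum.mem_resolventSet_iff, this]
  convert hu.neg using 1
  have e : algebraMap ℝ Q z.re = - (algebraMap ℝ Q (-z.re / 2) + algebraMap ℝ Q (-z.re / 2)) := by
    rw [← map_add, ← map_neg]; congr 1; ring
  rw [e]; abel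

theorem HasPosSquares.isPos_real_sub [Nontrivial Q] (hQ : HasPosSquares Q) {h : Q}
    (hh : IsSelfAdjoint h) {M : ℝ} (hM : ‖h‖ * ‖(1 : Q)‖ ≤ M) :
    IsPos (algebraMap ℝ Q M - h) := by
  have hs := (isSelfAdjoint_algebraMap_real M).sub hh
  refine ⟨hs, fun z hz => ⟨?_, hQ.im_eq_zero hs hz⟩⟩
  rw [sub_eq_add_neg, add_comm, mem_spectrum_add_real] at hz
  have h1 := spectrum.norm_le_norm_mul_of_mem hz
  rw [norm_neg] at h1
  have h2 := (abs_le.1 ((Complex.abs_re_le_norm _).trans (h1.trans hM))).1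
  simp only [Complex.sub_re, Complex.ofReal_re] at h2
  linarith

end

end Positive

/-! ### Positive functionals and the GNS construction for symmetric Banach `*`-algebras -/

section GNS

open Complex UniformSpace

variable {Q : Type u} [NormedRing Q] [NormedAlgebra ℂ Q] [StarRing Q] [StarModule ℂ Q]

/-- A linear functional that is non-negative on the self-adjoint elements of non-negative
spectrum. -/
structure PosFunctional (Q : Type u) [NormedRing Q] [NormedAlgebra ℂ Q] [StarRing Q] where
  toLin : Q →ₗ[ℂ] ℂ
  map_star : ∀ x, toLin (star x) = star (toLin x)
  nonneg : ∀ h, IsPos h → 0 ≤ (toLin h).re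

variable [CompleteSpace Q] [NormedStarGroup Q]

theorem not_isUnit_real_smul [Nontrivial Q] {b : Q} (hb : ¬ IsUnit b) (t : ℝ) :
    ¬ IsUnit (t • b) := by
  rcases eq_or_ne t 0 with rfl | ht
  · simp
  · intro h
    have := h.smul (Units.mk0 t⁻¹ (inv_ne_zero ht))
    rw [Units.smul_mk0, smul_smul, inv_mul_cancel₀ ht, one_smul] at this
    exact hb this

/-- The convex cone generated by the positive elements and the line through `b`. -/
def posConeAdd [Nontrivial Q] (hQ : HasPosSquares Q) (b : selfAdjoint Q) :
    PointedCone ℝ (selfAdjoint Q) where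
  carrier := {h | ∃ t : ℝ, IsPos ((h + t • b : selfAdjoint Q) : Q)}
  zero_mem' := ⟨0, by simpa using hQ 0⟩
  add_mem' := by
    rintro h k ⟨s, hs⟩ ⟨t, ht⟩
    refine ⟨s + t, ?_⟩
    have e : h + k + (s + t) • b = (h + s • b) + (k + t • b) := by rw [add_smul]; abel
    rw [e, AddSubgroup.coe_add]
    exact hQ.isPos_add hs ht
  smul_mem' := by
    rintro ⟨c, hc⟩ h ⟨s, hs⟩
    refine ⟨c * s, ?_⟩
    have e : (⟨c, hc⟩ : {r : ℝ // 0 ≤ r}) • h + (c * s) • b = c • (h + s • b) := by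
      rw [smul_add, smul_smul]; rfl
    rw [e, selfAdjoint.val_smul]
    exact hs.smul hc

/-- The Riesz extension theorem, applied to `s • 1 ↦ s` and the positive cone enlarged by the whole
line `ℝ b`. Non-negativity on both `b` and `-b` forces the extension to vanish at `b`. -/
theorem exists_real_state [Nontrivial Q] (hQ : HasPosSquares Q) (b : selfAdjoint Q)
    (hb : ¬ IsUnit (b : Q)) :
    ∃ φ : selfAdjoint Q →ₗ[ℝ] ℝ, φ 1 = 1 ∧ φ b = 0 ∧ ∀ h : selfAdjoint Q, IsPos (h : Q) →
      0 ≤ φ h := by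
  have h1 : (1 : selfAdjoint Q) ≠ 0 := fun h =>
    one_ne_zero (α := Q) (congrArg Subtype.val h)
  obtain ⟨φ, hφ, hp⟩ := riesz_extension (posConeAdd hQ b)
    (LinearPMap.mkSpanSingleton (1 : selfAdjoint Q) (1 : ℝ) h1) (by
      rintro ⟨x, hx⟩ ⟨t, ht⟩
      obtain ⟨s, rfl⟩ := Submodule.mem_span_singleton.1 hx
      rw [LinearPMap.mkSpanSingleton'_apply, RingHom.id_apply, smul_eq_mul, mul_one]
      -- As `t • b` is singular, `s` is a spectral value of `s • 1 + t • b`; if that element is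
      -- positive, then `0 ≤ s`.
      have hs : (s : ℂ) ∈ spectrum ℂ ((s • (1 : selfAdjoint Q) + t • b : selfAdjoint Q) : Q) := by
        have e : ((s • (1 : selfAdjoint Q) + t • b : selfAdjoint Q) : Q) =
            t • (b : Q) + algebraMap ℝ Q s := by
          rw [Algebra.algebraMap_eq_smul_one, add_comm]; rfl
        rw [e, mem_spectrum_add_real, sub_self, spectrum.zero_mem_iff]
        exact not_isUnit_real_smul hb t
      simpa using (ht.2 _ hs).1) (by
      intro y
      refine ⟨⟨(‖(-y : Q)‖ * ‖(1 : Q)‖) • (1 : selfAdjoint Q),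
        Submodule.smul_mem _ _ (Submodule.mem_span_singleton_self _)⟩, 0, ?_⟩
      have := hQ.isPos_real_sub (h := (-y : Q)) y.2.neg le_rfl
      rw [sub_neg_eq_add, Algebra.algebraMap_eq_smul_one] at this
      simpa using this)
  have mem : ∀ h : selfAdjoint Q, (∃ t : ℝ, IsPos ((h + t • b : selfAdjoint Q) : Q)) → 0 ≤ φ h :=
    fun h hh => hp h hh
  refine ⟨φ, ?_, ?_, fun h hh => mem h ⟨0, by simpa using hh⟩⟩
  · rw [hφ ⟨1, Submodule.mem_span_singleton_self _⟩]
    exact LinearPMap.mkSpanSingleton_apply ℝ ℝ h1 (1 : ℝ)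
  · have p1 := mem b ⟨-1, by simpa using hQ 0⟩
    have p2 := mem (-b) ⟨1, by simpa using hQ 0⟩
    rw [map_neg] at p2
    linarith

theorem exists_posFunctional [Nontrivial Q] (hQ : HasPosSquares Q) {b : Q}
    (hbs : IsSelfAdjoint b) (hb : ¬ IsUnit b) :
    ∃ f : PosFunctional Q, f.toLin 1 = 1 ∧ f.toLin b = 0 := by
  obtain ⟨φ, h1, h0, hp⟩ := exists_real_state hQ ⟨b, hbs⟩ hb
  -- The complex-linear functional with real part `φ ∘ realPart`; it agrees with `φ` on self-adjoint
  -- `h` because `I • h` has zero real part.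
  set F : Q →ₗ[ℂ] ℂ := Module.Dual.extendRCLike (𝕜 := ℂ) (φ ∘ₗ realPart) with hF
  have hFsa : ∀ h : selfAdjoint Q, F h = φ h := by
    intro h
    have hi : realPart ((I : ℂ) • (h : Q)) = 0 := by
      rw [realPart_I_smul, h.2.imaginaryPart, neg_zero]
    have hr : realPart (h : Q) = h := Subtype.ext h.2.coe_realPart
    rw [hF, Module.Dual.extendRCLike_apply]
    simp [hi, hr]
  refine ⟨⟨F, fun x => ?_, fun h hh => ?_⟩, ?_, ?_⟩
  · have hx := realPart_add_I_smul_imaginaryPart x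
    have e : F x = φ (realPart x) + I * φ (imaginaryPart x) := by
      conv_lhs => rw [← hx]
      rw [map_add, map_smul, hFsa, hFsa, smul_eq_mul]
    have e' : F (star x) = φ (realPart x) - I * φ (imaginaryPart x) := by
      conv_lhs => rw [← hx]
      rw [star_add, star_smul, (realPart x).2.star_eq, (imaginaryPart x).2.star_eq, map_add,
        map_smul, hFsa, hFsa]
      simp [sub_eq_add_neg]
    rw [e, e']
    simp [sub_eq_add_neg]
  · rw [hFsa ⟨h, hh.1⟩, ofReal_re]
    exact hp _ hh
  · have := hFsa 1
    rw [h1] at this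
    simpa using this
  · have := hFsa ⟨b, hbs⟩
    rw [h0] at this
    simpa using this

namespace PosFunctional

/-- The algebra `Q` with the semi-inner product `⟪x, y⟫ = f (star x * y)`. -/
@[nolint unusedArguments]
def PreGNS (_f : PosFunctional Q) (_hQ : HasPosSquares Q) : Type u := Q

variable (f : PosFunctional Q) (hQ : HasPosSquares Q)

instance : AddCommGroup (f.PreGNS hQ) := inferInstanceAs (AddCommGroup Q)

instance : Module ℂ (f.PreGNS hQ) := inferInstanceAs (Module ℂ Q)

/-- The identity map `Q → f.PreGNS hQ`. -/
def toPre : Q ≃ₗ[ℂ] f.PreGNS hQ := LinearEquiv.refl ℂ _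

/-- The identity map `f.PreGNS hQ → Q`. -/
def ofPre : f.PreGNS hQ ≃ₗ[ℂ] Q := (f.toPre hQ).symm

@[simp] theorem ofPre_toPre (x : Q) : f.ofPre hQ (f.toPre hQ x) = x := rfl

/-- The semi-inner product of a positive functional. -/
abbrev core : PreInnerProductSpace.Core ℂ (f.PreGNS hQ) where
  inner a b := f.toLin (star (f.ofPre hQ a) * f.ofPre hQ b)
  conj_inner_symm a b := by
    rw [starRingEnd_apply, ← f.map_star, star_mul, star_star]
  re_inner_nonneg a := f.nonneg _ (hQ _)
  add_left a b c := by rw [map_add, star_add, add_mul, map_add]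
  smul_left a b c := by simp

instance : SeminormedAddCommGroup (f.PreGNS hQ) :=
  InnerProductSpace.Core.toSeminormedAddCommGroup (c := f.core hQ)

instance : InnerProductSpace ℂ (f.PreGNS hQ) := InnerProductSpace.ofCore (f.core hQ)

theorem inner_def (a b : f.PreGNS hQ) :
    inner ℂ a b = f.toLin (star (f.ofPre hQ a) * f.ofPre hQ b) := rfl

theorem norm_sq (a : f.PreGNS hQ) :
    ‖a‖ ^ 2 = (f.toLin (star (f.ofPre hQ a) * f.ofPre hQ a)).re := by
  rw [← inner_def]
  exact norm_sq_eq_re_inner (𝕜 := ℂ) a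

/-- Boundedness of left multiplication in the GNS seminorm: `M + 1 - star x * x` is a square `u * u`
with `u` self-adjoint, and `f` is non-negative on `star (u * y) * (u * y)`. The summand `1` makes
the element strictly positive, so that the root exists. -/
theorem apply_mul_le [Nontrivial Q] (hQ : HasPosSquares Q) (x y : Q) :
    (f.toLin (star (x * y) * (x * y))).re ≤
      (‖x‖ ^ 2 * ‖(1 : Q)‖ + 1) * (f.toLin (star y * y)).re := by
  set M : ℝ := ‖x‖ ^ 2 * ‖(1 : Q)‖ with hM
  have hle : ‖star x * x‖ * ‖(1 : Q)‖ ≤ M := by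
    refine mul_le_mul_of_nonneg_right ?_ (norm_nonneg _)
    exact (norm_mul_le _ _).trans_eq (by rw [norm_star, sq])
  obtain ⟨u, hu, huu⟩ := ((hQ.isPos_real_sub (.star_mul_self x) hle).add_real
    one_pos).exists_mul_self_eq
  have h := f.nonneg _ (hQ (u * y))
  have e : star (u * y) * (u * y) = (M + 1) • (star y * y) - star (x * y) * (x * y) := by
    rw [star_mul, star_mul, hu.star_eq, mul_assoc, ← mul_assoc u u, huu, map_one,
      Algebra.algebraMap_eq_smul_one]
    simp only [add_mul, sub_mul, mul_add, mul_sub, one_mul, smul_mul_assoc, mul_smul_comm, add_smul,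
      one_smul, mul_assoc]
    abel
  rw [e, map_sub, ← Complex.coe_smul, map_smul, sub_re, smul_eq_mul, re_ofReal_mul] at h
  linarith

variable [Nontrivial Q]

/-- Left multiplication as a bounded operator. -/
def leftMul (x : Q) : f.PreGNS hQ →L[ℂ] f.PreGNS hQ :=
  LinearMap.mkContinuous
    ((f.toPre hQ).toLinearMap ∘ₗ LinearMap.mulLeft ℂ x ∘ₗ (f.ofPre hQ).toLinearMap)
    (Real.sqrt (‖x‖ ^ 2 * ‖(1 : Q)‖ + 1)) fun y => by
      rw [← sq_le_sq₀ (norm_nonneg _) (by positivity), mul_pow, Real.sq_sqrt (by positivity),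
        norm_sq, norm_sq]
      exact f.apply_mul_le hQ x _

theorem leftMul_apply (x : Q) (y : f.PreGNS hQ) :
    f.leftMul hQ x y = f.toPre hQ (x * f.ofPre hQ y) := rfl

theorem clm_ext {S T : Completion (f.PreGNS hQ) →L[ℂ] Completion (f.PreGNS hQ)}
    (h : ∀ y : f.PreGNS hQ, S y = T y) : S = T := by
  ext y
  induction y using Completion.induction_on with
  | hp => exact isClosed_eq S.continuous T.continuous
  | ih y => exact h y

/-- The GNS representation of a positive functional. -/
def gns : Q →⋆ₙₐ[ℂ] (Completion (f.PreGNS hQ) →L[ℂ] Completion (f.PreGNS hQ)) where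
  toFun a := (f.leftMul hQ a).completion
  map_smul' c a := f.clm_ext hQ fun y => by
    rw [ContinuousLinearMap.completion_apply_coe, leftMul_apply, smul_mul_assoc, map_smul,
      Completion.coe_smul, MonoidHom.id_apply, _root_.smul_apply,
      ContinuousLinearMap.completion_apply_coe, leftMul_apply]
  map_zero' := f.clm_ext hQ fun y => by
    rw [ContinuousLinearMap.completion_apply_coe, leftMul_apply, zero_mul, map_zero,
      Completion.coe_zero, _root_.zero_apply]
  map_add' a b := f.clm_ext hQ fun y => by
    rw [ContinuousLinearMap.completion_apply_coe, leftMul_apply, add_mul, map_add,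
      Completion.coe_add, _root_.add_apply,
      ContinuousLinearMap.completion_apply_coe, ContinuousLinearMap.completion_apply_coe,
      leftMul_apply, leftMul_apply]
  map_mul' a b := f.clm_ext hQ fun y => by
    rw [ContinuousLinearMap.completion_apply_coe, leftMul_apply, mul_assoc,
      mul_apply_eq_comp,
      ContinuousLinearMap.completion_apply_coe, ContinuousLinearMap.completion_apply_coe,
      leftMul_apply, leftMul_apply, ofPre_toPre]
  map_star' a := by
    refine (ContinuousLinearMap.eq_adjoint_iff (f.leftMul hQ (star a)).completion
      (f.leftMul hQ a).completion).mpr fun x y => ?_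
    induction x, y using Completion.induction_on₂ with
    | hp => apply isClosed_eq <;> fun_prop
    | ih x y => simp [leftMul_apply, mul_assoc, inner_def]

theorem gns_coe (a : Q) (y : f.PreGNS hQ) : f.gns hQ a y = f.leftMul hQ a y := by
  change (f.leftMul hQ a).completion y = _
  simp

end PosFunctional

/-- In a symmetric Banach `*`-algebra, if `star x * x` is not invertible, then some
representation of `x` has a non-zero kernel. -/
theorem HasPosSquares.exists_hilbertRep [Nontrivial Q] (hQ : HasPosSquares Q) {x : Q}
    (hx : ¬ IsUnit (star x * x)) :
    ∃ (π : HilbertRep Q) (ξ : π.H), ξ ≠ 0 ∧ π.toHom 1 ξ = ξ ∧ π.toHom x ξ = 0 := by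
  obtain ⟨f, h1, h0⟩ := exists_posFunctional hQ (.star_mul_self x) hx
  have hn : ∀ y : Q, ‖((f.toPre hQ y : f.PreGNS hQ) : Completion (f.PreGNS hQ))‖ ^ 2 =
      (f.toLin (star y * y)).re := by
    intro y
    rw [Completion.norm_coe, f.norm_sq hQ]
    rfl
  refine ⟨{ H := Completion (f.PreGNS hQ), toHom := f.gns hQ },
    (f.toPre hQ 1 : Completion (f.PreGNS hQ)), ?_, ?_, ?_⟩
  · intro h
    have := hn 1
    rw [h] at this
    simp [h1] at this
  · change f.gns hQ 1 (f.toPre hQ 1 : Completion (f.PreGNS hQ)) = _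
    rw [f.gns_coe, f.leftMul_apply, one_mul]
    rfl
  · change f.gns hQ x (f.toPre hQ 1 : Completion (f.PreGNS hQ)) = 0
    rw [f.gns_coe, f.leftMul_apply, f.ofPre_toPre, mul_one, ← norm_eq_zero, ← sq_eq_zero_iff, hn,
      h0, zero_re]

end GNS

/-! ### Quotients of Banach `*`-algebras -/

section Quotient

variable {X : Type u} [NormedRing X] [NormedAlgebra ℂ X] [StarRing X] [StarModule ℂ X]
  [NormedStarGroup X] [CompleteSpace X]

variable (X) in
/-- A closed two-sided `*`-ideal of a Banach `*`-algebra. -/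
structure ClosedStarIdeal where
  toIdeal : Ideal X
  isTwoSided : toIdeal.IsTwoSided
  isClosed : IsClosed (toIdeal : Set X)
  star_mem : ∀ x ∈ toIdeal, star x ∈ toIdeal

attribute [instance] ClosedStarIdeal.isTwoSided ClosedStarIdeal.isClosed

variable (N : ClosedStarIdeal X)

/-- The quotient of a Banach `*`-algebra by a closed two-sided `*`-ideal. -/
abbrev ClosedStarIdeal.Quot : Type u := X ⧸ N.toIdeal

namespace ClosedStarIdeal

/-- The quotient map. -/
def proj : X →+* N.Quot := Ideal.Quotient.mk N.toIdeal

theorem proj_surjective : Function.Surjective N.proj := Ideal.Quotient.mk_surjective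

theorem proj_eq_proj_iff {x y : X} : N.proj x = N.proj y ↔ x - y ∈ N.toIdeal := Ideal.Quotient.eq

theorem norm_proj_le (x : X) : ‖N.proj x‖ ≤ ‖x‖ := Submodule.Quotient.norm_mk_le N.toIdeal x

theorem exists_norm_lt (q : N.Quot) {ε : ℝ} (hε : 0 < ε) : ∃ x, N.proj x = q ∧ ‖x‖ < ‖q‖ + ε :=
  Submodule.Quotient.norm_mk_lt q hε

theorem norm_le_of_forall {q : N.Quot} {c : ℝ} (h : ∀ ε > 0, ∃ x, N.proj x = q ∧ ‖x‖ ≤ c + ε) :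
    ‖q‖ ≤ c := by
  refine le_of_forall_pos_le_add fun ε hε => ?_
  obtain ⟨x, rfl, hx⟩ := h ε hε
  exact (N.norm_proj_le x).trans hx

instance : NormedRing N.Quot :=
  { (inferInstance : NormedAddCommGroup N.Quot), Ideal.Quotient.ring N.toIdeal with
    norm_mul_le := fun p q => by
      have h : ∀ ε > 0, ‖p * q‖ ≤ (‖p‖ + ε) * (‖q‖ + ε) := by
        intro ε hε
        obtain ⟨x, rfl, hx⟩ := N.exists_norm_lt p hε
        obtain ⟨y, rfl, hy⟩ := N.exists_norm_lt q hε
        calc ‖N.proj x * N.proj y‖ = ‖N.proj (x * y)‖ := by rw [map_mul]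
          _ ≤ ‖x‖ * ‖y‖ := (N.norm_proj_le _).trans (norm_mul_le x y)
          _ ≤ _ := mul_le_mul hx.le hy.le (norm_nonneg _) (by positivity)
      have hl : Filter.Tendsto (fun ε : ℝ => (‖p‖ + ε) * (‖q‖ + ε)) (nhdsWithin 0 (Set.Ioi 0))
          (nhds ((‖p‖ + 0) * (‖q‖ + 0))) := by
        refine Filter.Tendsto.mono_left (Continuous.tendsto ?_ 0) nhdsWithin_le_nhds
        fun_prop
      rw [add_zero, add_zero] at hl
      exact ge_of_tendsto hl (Filter.eventually_of_mem self_mem_nhdsWithin h) }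

instance : NormedAlgebra ℂ N.Quot :=
  { Submodule.Quotient.normedSpace N.toIdeal ℂ with
    algebraMap := N.proj.comp (algebraMap ℂ X)
    commutes' := fun c q => by
      obtain ⟨x, rfl⟩ := N.proj_surjective q
      rw [RingHom.comp_apply, ← map_mul, ← map_mul, Algebra.commutes]
    smul_def' := fun c q => by
      obtain ⟨x, rfl⟩ := N.proj_surjective q
      rw [RingHom.comp_apply, ← map_mul, ← Algebra.smul_def]
      rfl }

theorem proj_algebraMap (c : ℂ) : N.proj (algebraMap ℂ X c) = algebraMap ℂ N.Quot c := rfl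

theorem proj_smul (c : ℂ) (x : X) : N.proj (c • x) = c • N.proj x := rfl

instance : CompleteSpace N.Quot := Submodule.Quotient.completeSpace N.toIdeal

instance : Star N.Quot :=
  ⟨Quotient.lift (fun x => N.proj (star x)) fun x y h => by
    have h' : x - y ∈ N.toIdeal := (Submodule.quotientRel_def _).1 h
    rw [proj_eq_proj_iff, ← star_sub]
    exact N.star_mem _ h'⟩

theorem proj_star (x : X) : N.proj (star x) = star (N.proj x) := rfl

instance : StarRing N.Quot where
  star_involutive q := by
    obtain ⟨x, rfl⟩ := N.proj_surjective q
    rw [← proj_star, ← proj_star, star_star]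
  star_mul p q := by
    obtain ⟨x, rfl⟩ := N.proj_surjective p
    obtain ⟨y, rfl⟩ := N.proj_surjective q
    rw [← map_mul, ← proj_star, ← proj_star, ← proj_star, ← map_mul, star_mul]
  star_add p q := by
    obtain ⟨x, rfl⟩ := N.proj_surjective p
    obtain ⟨y, rfl⟩ := N.proj_surjective q
    rw [← map_add, ← proj_star, ← proj_star, ← proj_star, ← map_add, star_add]

instance : StarModule ℂ N.Quot where
  star_smul c q := by
    obtain ⟨x, rfl⟩ := N.proj_surjective q
    rw [← proj_smul, ← proj_star, ← proj_star, star_smul, proj_smul]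

instance : NormedStarGroup N.Quot where
  norm_star_le q := by
    refine N.norm_le_of_forall fun ε hε => ?_
    obtain ⟨x, rfl, hx⟩ := N.exists_norm_lt q hε
    exact ⟨star x, N.proj_star x, (norm_star x).trans_le hx.le⟩

/-- The quotient map as a `*`-homomorphism. -/
def projHom : X →⋆ₙₐ[ℂ] N.Quot where
  toFun := N.proj
  map_smul' := N.proj_smul
  map_zero' := map_zero _
  map_add' := map_add _
  map_mul' := map_mul _
  map_star' := N.proj_star

/-- Let `X` be a Banach `*`-algebra in which the elements `star f * f` have non-negative spectrum
modulo the closed `*`-ideal `N`. An element without left inverse modulo `N` has a non-zero kernel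
in some representation that annihilates `N`. -/
theorem exists_hilbertRep
    (hN : ∀ (f : X) (z : ℂ), ¬ (0 ≤ z.re ∧ z.im = 0) → ∃ y,
      y * (algebraMap ℂ X z - star f * f) - 1 ∈ N.toIdeal ∧
      (algebraMap ℂ X z - star f * f) * y - 1 ∈ N.toIdeal)
    {x : X} (hx : ∀ y, y * x - 1 ∉ N.toIdeal) :
    ∃ (π : HilbertRep X) (ξ : π.H), ξ ≠ 0 ∧ π.toHom 1 ξ = ξ ∧ π.toHom x ξ = 0 ∧
      ∀ y ∈ N.toIdeal, π.toHom y = 0 := by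
  have hQ : HasPosSquares N.Quot := by
    refine fun q => ⟨.star_mul_self q, fun z hz => ?_⟩
    obtain ⟨f, rfl⟩ := N.proj_surjective q
    by_contra h
    obtain ⟨y, h1, h2⟩ := hN f z h
    rw [← proj_eq_proj_iff, map_mul, map_sub, map_mul, map_one, proj_star, proj_algebraMap] at h1 h2
    exact hz ⟨⟨_, N.proj y, h2, h1⟩, rfl⟩
  have hu : ¬ IsUnit (star (N.proj x) * N.proj x) := by
    rintro ⟨u, hu⟩
    obtain ⟨y, hy⟩ := N.proj_surjective (↑u⁻¹ : N.Quot)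
    -- An inverse `y` of `star x * x` in the quotient makes `y * star x` a left inverse of `x`.
    refine hx (y * star x) ?_
    rw [← proj_eq_proj_iff, map_mul, map_mul, map_one, proj_star, mul_assoc, ← hu, hy, u.inv_mul]
  have : Nontrivial N.Quot := by
    by_contra h
    rw [not_nontrivial_iff_subsingleton] at h
    exact hu (isUnit_of_subsingleton _)
  obtain ⟨π, ξ, h0, h1, h2⟩ := hQ.exists_hilbertRep hu
  refine ⟨⟨π.H, π.toHom.comp N.projHom⟩, ξ, h0, h1, h2, fun y hy => ?_⟩
  have hy' : N.proj y = 0 := Ideal.Quotient.eq_zero_iff_mem.2 hy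
  change π.toHom (N.proj y) = 0
  rw [hy', map_zero]

end ClosedStarIdeal

end Quotient

/-! ### Spectral permanence for homomorphisms with controlled lifts -/

section Permanence

open Filter Topology

/-- A bounded subset of `ℂ` is contained in `[0, ∞)` if it is closed and its frontier is. -/
theorem nonneg_of_frontier_nonneg {s : Set ℂ} (hs : IsCompact s)
    (h : ∀ z ∈ frontier s, 0 ≤ z.re ∧ z.im = 0) : ∀ z ∈ s, 0 ≤ z.re ∧ z.im = 0 := by
  intro z hz
  by_contra hz0
  have hzne : z ≠ 0 := by
    rintro rfl
    simp at hz0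
  have hray : ∀ t : ℝ, 1 ≤ t → ¬ (0 ≤ ((t : ℂ) * z).re ∧ ((t : ℂ) * z).im = 0) := by
    intro t ht
    have ht0 : 0 < t := by linarith
    rw [Complex.re_ofReal_mul, Complex.im_ofReal_mul]
    rintro ⟨h1, h2⟩
    exact hz0 ⟨nonneg_of_mul_nonneg_right h1 ht0, by simpa [ht0.ne'] using h2⟩
  have hcont : Continuous fun t : ℝ => (t : ℂ) * z := by fun_prop
  obtain ⟨C, hC⟩ := hs.isBounded.exists_norm_le
  -- Move outwards from `z` along its ray, which never meets `[0, ∞)`. The last point of the ray in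
  -- the compact set `s` is a frontier point.
  set K : Set ℝ := Set.Icc 1 (C / ‖z‖) ∩ (fun t : ℝ => (t : ℂ) * z) ⁻¹' s with hK
  have hmem : ∀ t : ℝ, 1 ≤ t → (t : ℂ) * z ∈ s → t ∈ K := by
    intro t ht hts
    refine ⟨⟨ht, ?_⟩, hts⟩
    have := hC _ hts
    rw [norm_mul, Complex.norm_real, Real.norm_eq_abs, abs_of_pos (by linarith)] at this
    rwa [le_div_iff₀ (norm_pos_iff.2 hzne)]
  have hKc : IsCompact K := isCompact_Icc.inter_right (hs.isClosed.preimage hcont)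
  obtain ⟨t, ⟨⟨ht1, -⟩, hts⟩, htmax⟩ := hKc.exists_isGreatest ⟨1, hmem 1 le_rfl (by simpa using hz)⟩
  refine hray t ht1 (h _ ?_)
  rw [hs.isClosed.frontier_eq]
  refine ⟨hts, fun hint => ?_⟩
  have hev : ∀ᶠ r : ℝ in 𝓝 t, (r : ℂ) * z ∈ s :=
    hcont.continuousAt.eventually (mem_interior_iff_mem_nhds.1 hint)
  obtain ⟨r, hr, hrs⟩ := hev.exists_gt
  exact absurd (htmax (hmem r (by linarith) hrs)) (not_le.2 hr)

variable {X : Type v} [NonUnitalNormedRing X] [NormedSpace ℂ X] [IsScalarTower ℂ X X]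
  [SMulCommClass ℂ X X] [CompleteSpace X]
  {L : Type w} [NonUnitalNormedRing L] [NormedSpace ℂ L] [IsScalarTower ℂ L L]
  [SMulCommClass ℂ L L] [CompleteSpace L]

/-- A limit of values is an absolutely convergent series of values, and lifting the terms with norm
control gives a series that converges in the complete space `X`. -/
theorem isClosed_range_of_controlled_lift (Φ : X →ₙₐ[ℂ] L) (hΦ : ∀ x, ‖Φ x‖ ≤ ‖x‖) {C : ℝ}
    (hC : 0 < C) (hlift : ∀ x, ∃ x', Φ x' = Φ x ∧ ‖x'‖ ≤ C * ‖Φ x‖) :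
    IsClosed (Set.range Φ) := by
  let f : NormedAddGroupHom X L :=
    { toFun := Φ, map_add' := map_add Φ, bound' := ⟨1, fun x => by simpa using hΦ x⟩ }
  have hs : f.SurjectiveOnWith f.range C := by
    rintro _ ⟨x, rfl⟩
    exact hlift x
  have h := controlled_closure_of_complete hC one_pos hs
  have hr : (f.range : Set L) = Set.range Φ := by
    ext l
    exact Iff.rfl
  refine isClosed_of_closure_subset fun l hl => ?_
  rw [← hr] at hl
  obtain ⟨x, hx, -⟩ := h l hl
  exact ⟨x, hx⟩

/-- The subalgebra of the unitization of `L` generated by the unit and the range of `Φ`. -/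
def unitizationRange (Φ : X →ₙₐ[ℂ] L) : Subalgebra ℂ (WithLp 1 (Unitization ℂ L)) where
  carrier := {l | (WithLp.ofLp l).snd ∈ Set.range Φ}
  mul_mem' := by
    rintro l m ⟨x, hx⟩ ⟨y, hy⟩
    refine ⟨(WithLp.ofLp l).fst • y + (WithLp.ofLp m).fst • x + x * y, ?_⟩
    rw [WithLp.unitization_mul, Unitization.snd_mul, map_add, map_add, map_smul, map_smul, map_mul,
      hx, hy]
  add_mem' := by
    rintro l m ⟨x, hx⟩ ⟨y, hy⟩
    refine ⟨x + y, ?_⟩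
    rw [map_add, hx, hy]
    rfl
  algebraMap_mem' c := ⟨0, by
    rw [map_zero, WithLp.unitization_algebraMap, Unitization.algebraMap_eq_inl,
      Unitization.snd_inl]⟩

theorem continuous_unitization_snd :
    Continuous fun l : WithLp 1 (Unitization ℂ L) => (WithLp.ofLp l).snd := by
  refine (LipschitzWith.of_dist_le_mul (K := 1) fun l m => ?_).continuous
  rw [dist_eq_norm, dist_eq_norm, NNReal.coe_one, one_mul, WithLp.unitization_norm_def]
  exact le_add_of_nonneg_left (norm_nonneg _)

/-- Let `Φ : X → L` be a contractive homomorphism whose values have preimages of controlled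
norm. If `Φ a` has non-negative spectrum, then so does `a` modulo the kernel of `Φ`. -/
theorem exists_quasiInverse_of_controlled_lift (Φ : X →ₙₐ[ℂ] L) (hΦ : ∀ x, ‖Φ x‖ ≤ ‖x‖) {C : ℝ}
    (hC : 0 < C) (hlift : ∀ x, ∃ x', Φ x' = Φ x ∧ ‖x'‖ ≤ C * ‖Φ x‖) {a : X}
    (ha : ∀ z ∈ quasispectrum ℂ (Φ a), 0 ≤ z.re ∧ z.im = 0) {z : ℂ}
    (hz : ¬ (0 ≤ z.re ∧ z.im = 0)) :
    ∃ y, Φ (z • y - z⁻¹ • a - y * a) = 0 ∧ Φ (z • y - z⁻¹ • a - a * y) = 0 := by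
  have hz0 : z ≠ 0 := by
    rintro rfl
    simp at hz
  set D := unitizationRange Φ with hD
  have hDc : IsClosed (D : Set (WithLp 1 (Unitization ℂ L))) :=
    (isClosed_range_of_controlled_lift Φ hΦ hC hlift).preimage continuous_unitization_snd
  have : CompleteSpace D := hDc.completeSpace_coe
  let b : D := ⟨WithLp.toLp 1 (Φ a : Unitization ℂ L), a, rfl⟩
  have hb : ∀ w ∈ spectrum ℂ b, 0 ≤ w.re ∧ w.im = 0 := by
    refine nonneg_of_frontier_nonneg (spectrum.isCompact b) fun w hw => ha w ?_
    -- The frontier of the spectrum in a closed subalgebra lies in the spectrum in the whole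
    -- algebra, where non-negativity is known.
    have := Subalgebra.frontier_spectrum D b hw
    rw [Unitization.quasispectrum_eq_spectrum_inr ℂ]
    rwa [← AlgEquiv.spectrum_eq (WithLp.unitizationAlgEquiv (𝕜 := ℂ) (A := L) ℂ).symm]
  have hu : IsUnit (algebraMap ℂ D z - b) := by
    by_contra h
    exact hz (hb z h)
  obtain ⟨u, hu⟩ := hu
  obtain ⟨y, hy⟩ := (↑u⁻¹ : D).2
  have h1 : (WithLp.ofLp ((↑u⁻¹ : D) : WithLp 1 (Unitization ℂ L))) *
      (algebraMap ℂ (Unitization ℂ L) z - (Φ a : Unitization ℂ L)) = 1 := by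
    have h := congrArg (fun d : D => WithLp.ofLp (d : WithLp 1 (Unitization ℂ L))) u.inv_mul
    rw [hu] at h
    exact h
  have h2 : (algebraMap ℂ (Unitization ℂ L) z - (Φ a : Unitization ℂ L)) *
      (WithLp.ofLp ((↑u⁻¹ : D) : WithLp 1 (Unitization ℂ L))) = 1 := by
    have h := congrArg (fun d : D => WithLp.ofLp (d : WithLp 1 (Unitization ℂ L))) u.mul_inv
    rw [hu] at h
    exact h
  set v := WithLp.ofLp ((↑u⁻¹ : D) : WithLp 1 (Unitization ℂ L)) with hv
  have ef : (algebraMap ℂ (Unitization ℂ L) z - (Φ a : Unitization ℂ L)).fst = z := by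
    rw [sub_eq_add_neg]
    simp [Unitization.algebraMap_eq_inl]
  have es : (algebraMap ℂ (Unitization ℂ L) z - (Φ a : Unitization ℂ L)).snd = -Φ a := by
    rw [sub_eq_add_neg]
    simp [Unitization.algebraMap_eq_inl]
  -- The inverse of `z - Φ a` has the form `z⁻¹ + Φ y`; the second components of the two inverse
  -- identities are the required relations.
  have hf : v.fst = z⁻¹ := by
    have := congrArg (fun t : Unitization ℂ L => t.fst) h1
    simp only [Unitization.fst_mul, ef, Unitization.fst_one] at this
    exact eq_inv_of_mul_eq_one_left this
  have e1 := congrArg (fun t : Unitization ℂ L => t.snd) h1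
  have e2 := congrArg (fun t : Unitization ℂ L => t.snd) h2
  simp only [Unitization.snd_mul, ef, es, Unitization.snd_one, hf, ← hy, mul_neg, neg_mul,
    smul_neg] at e1 e2
  refine ⟨y, ?_, ?_⟩
  · rw [map_sub, map_sub, map_smul, map_smul, map_mul, ← e1]
    abel
  · rw [map_sub, map_sub, map_smul, map_smul, map_mul, ← e2]
    abel

end Permanence

/-! ### Point masses and the unit of the twisted `ℓ¹`-algebra -/

namespace L1

open scoped Classical

variable {G : Type u} [Group G] {A : Type v} [NormedAddCommGroup A] [NormedSpace ℂ A]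
  {S : FiberStructure G A}

theorem hasSum_norm_ite (x : G) (a : A) :
    HasSum (fun y => ‖(Pi.single x a : G → A) y‖) ‖a‖ := by
  have h := hasSum_single (f := fun y => ‖(Pi.single x a : G → A) y‖) x fun y hy => by
    rw [Pi.single_eq_of_ne hy, norm_zero]
  rwa [Pi.single_eq_same] at h

/-- The function with value `a` at `x` that vanishes elsewhere. -/
def single (x : G) (a : A) : L1 S := mk (Pi.single x a) (hasSum_norm_ite x a).summable

theorem single_apply (x : G) (a : A) (y : G) : (single x a : L1 S) y = (Pi.single x a : G → A) y :=
  rfl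

@[simp] theorem single_self (x : G) (a : A) : (single x a : L1 S) x = a := by
  rw [single_apply, Pi.single_eq_same]

theorem single_of_ne {x y : G} (h : y ≠ x) (a : A) : (single x a : L1 S) y = 0 := by
  rw [single_apply, Pi.single_eq_of_ne h]

theorem norm_single (x : G) (a : A) : ‖(single x a : L1 S)‖ = ‖a‖ := by
  rw [norm_eq]
  exact (hasSum_norm_ite x a).tsum_eq

/-- `single x` as a bounded linear map. -/
def singleL (S : FiberStructure G A) (x : G) : A →L[ℂ] L1 S :=
  LinearMap.mkContinuous
    { toFun := single x
      map_add' := fun a b => ext fun y => by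
        rw [add_apply, single_apply, single_apply, single_apply, Pi.single_add, Pi.add_apply]
      map_smul' := fun c a => ext fun y => by
        rw [smul_apply, single_apply, single_apply, Pi.single_smul, Pi.smul_apply,
          RingHom.id_apply] } 1
    fun a => by simpa using (norm_single x a).le

@[simp] theorem singleL_apply (x : G) (a : A) : singleL S x a = single x a := rfl

theorem hasSum_single_self (f : L1 S) : HasSum (fun x => (single x (f x) : L1 S)) f :=
  lp.hasSum_single (p := 1) ENNReal.one_ne_top (show lp (fun _ : G => A) 1 from f)

variable [CompleteSpace A]

theorem single_mul_apply (x : G) (a : A) (f : L1 S) (y : G) :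
    (single x a * f : L1 S) y = S.mul x (x⁻¹ * y) a (f (x⁻¹ * y)) := by
  rw [mul_apply, tsum_eq_single x, single_self]
  intro z hz
  rw [single_of_ne hz, map_zero, _root_.zero_apply]

theorem single_mul_single (x y : G) (a b : A) :
    (single x a * single y b : L1 S) = single (x * y) (S.mul x y a b) := by
  refine ext fun z => ?_
  rw [single_mul_apply]
  by_cases h : z = x * y
  · subst h
    rw [single_self, inv_mul_cancel_left, single_self]
  · rw [single_of_ne h, single_of_ne, map_zero]
    rintro rfl
    exact h (mul_inv_cancel_left x z).symm

theorem star_single (x : G) (a : A) :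
    star (single x⁻¹ a : L1 S) = single x (S.inv x a) := by
  refine ext fun z => ?_
  rw [star_apply]
  by_cases h : z = x
  · subst h
    rw [single_self, single_self]
  · rw [single_of_ne h, single_of_ne, map_zero]
    exact fun h' => h (inv_injective h')

end L1

namespace TwistedAction

open L1

variable {G : Type u} [Group G] {A : Type v} [CStarAlgebra A] (S : TwistedAction G A)

theorem α_one (a : A) : S.α 1 a = a := by
  apply (S.α 1).injective
  simpa [S.ω_one_left] using S.α_comp 1 1 a

theorem α_ω_inv (x : G) : S.α x (S.ω x⁻¹ x : A) = (S.ω x x⁻¹ : A) := by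
  simpa [S.ω_one_left, S.ω_one_right] using (S.cocycle x x⁻¹ x).symm

theorem fibers_mul (x y : G) (a b : A) : S.fibers.mul x y a b = a * S.α x b * (S.ω x y : A) := rfl

theorem fibers_inv (x : G) (a : A) :
    S.fibers.inv x a = star (S.ω x x⁻¹ : A) * star (S.α x a) := rfl

theorem single_one_mul (f : S.TwistedL1) : single 1 1 * f = f := by
  refine ext fun x => ?_
  rw [single_mul_apply, fibers_mul, inv_one, one_mul, one_mul, S.α_one, S.ω_one_left]
  simp

theorem mul_single_one (f : S.TwistedL1) : f * single 1 1 = f := by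
  refine ext fun x => ?_
  rw [S.twisted_mul_apply, tsum_eq_single x]
  · simp [S.ω_one_right]
  · intro y hy
    rw [single_of_ne, map_zero, mul_zero, zero_mul]
    exact fun h => hy (inv_mul_eq_one.1 h)

instance : NormedRing S.TwistedL1 :=
  { (inferInstance : NonUnitalNormedRing S.TwistedL1) with
    one := single 1 1
    one_mul := S.single_one_mul
    mul_one := S.mul_single_one }

instance : NormedAlgebra ℂ S.TwistedL1 :=
  { (inferInstance : NormedSpace ℂ S.TwistedL1), Algebra.ofModule smul_mul_assoc mul_smul_comm with }

/-- Every point mass is the product of one at the unit and a contraction. -/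
theorem single_one_mul_single (x : G) (a : A) :
    (single 1 a * single x 1 : S.TwistedL1) = single x a := by
  rw [single_mul_single, fibers_mul, one_mul, map_one, mul_one, S.ω_one_left]
  simp

/-- Together with `single_one_mul_single`, this moves norm estimates between the fibre at `x` and
the coefficient algebra at `1`. -/
theorem single_mul_star_single (x : G) (a : A) :
    (single x a * star (single x 1) : S.TwistedL1) = single 1 a := by
  have h : star (single x 1 : S.TwistedL1) = single x⁻¹ (S.fibers.inv x⁻¹ 1) := by
    rw [← star_single, inv_inv]
  rw [h, single_mul_single, fibers_mul, fibers_inv, mul_inv_cancel, inv_inv, map_one, star_one,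
    mul_one, map_star, S.α_ω_inv, mul_assoc, S.star_ω_mul, mul_one]

end TwistedAction

/-! ### Lifting along homomorphisms of `C^*`-algebras -/

section Lift

variable {A : Type v} [NonUnitalCStarAlgebra A] {B : Type w} [NonUnitalCStarAlgebra B]

/-- Truncate `a` by functional calculus at height `r = ‖θ a‖`. The truncation is the identity on the
spectrum of `θ a`, so the image does not change. -/
theorem exists_lift_of_isSelfAdjoint (θ : A →⋆ₙₐ[ℂ] B) {a : A} (ha : IsSelfAdjoint a) :
    ∃ a', θ a' = θ a ∧ ‖a'‖ ≤ ‖θ a‖ := by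
  set r := ‖θ a‖ with hr
  have hr0 : 0 ≤ r := norm_nonneg _
  set f : ℝ → ℝ := fun t => max (-r) (min t r) with hf
  have hfc : Continuous f := by fun_prop
  have hf0 : f 0 = 0 := by simp [hf, hr0]
  have hθ : Continuous θ := by
    refine AddMonoidHomClass.continuous_of_bound θ 1 fun x => ?_
    simpa using norm_hom_le θ x
  have hθa : IsSelfAdjoint (θ a) := ha.map θ
  refine ⟨cfcₙ f a, ?_, ?_⟩
  · rw [NonUnitalStarAlgHomClass.map_cfcₙ (S := ℂ) θ f a hfc.continuousOn hf0 hθ ha hθa]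
    conv_rhs => rw [← cfcₙ_id' ℝ (θ a)]
    refine cfcₙ_congr fun t ht => ?_
    have h : ‖t‖ ≤ r := by
      have := NonUnitalIsometricContinuousFunctionalCalculus.norm_quasispectrum_le (𝕜 := ℝ) (θ a) ht
      exact this
    rw [Real.norm_eq_abs, abs_le] at h
    simp [hf, h.1, h.2]
  · refine norm_cfcₙ_le fun t _ => ?_
    rw [Real.norm_eq_abs, abs_le]
    exact ⟨le_max_left _ _, max_le (by linarith) (min_le_right _ _)⟩

theorem exists_lift_norm_le (θ : A →⋆ₙₐ[ℂ] B) (a : A) :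
    ∃ a', θ a' = θ a ∧ ‖a'‖ ≤ 2 * ‖θ a‖ := by
  obtain ⟨x, hx, hx'⟩ := exists_lift_of_isSelfAdjoint θ (realPart a).2
  obtain ⟨y, hy, hy'⟩ := exists_lift_of_isSelfAdjoint θ (imaginaryPart a).2
  have h1 : ‖θ (realPart a : A)‖ ≤ ‖θ a‖ := by
    rw [map_realPart θ a]
    exact realPart.norm_le (θ a)
  have h2 : ‖θ (imaginaryPart a : A)‖ ≤ ‖θ a‖ := by
    rw [map_imaginaryPart θ a]
    exact imaginaryPart.norm_le (θ a)
  refine ⟨x + Complex.I • y, ?_, ?_⟩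
  · conv_rhs => rw [← realPart_add_I_smul_imaginaryPart a]
    rw [map_add, map_add, map_smul, map_smul, hx, hy]
  · refine (norm_add_le _ _).trans ?_
    rw [norm_smul, Complex.norm_I, one_mul]
    linarith

end Lift

/-! ### A small `C^*`-algebra with the kernel of the universal representation -/

section Family

variable {𝔅 : Type u} [NonUnitalNormedRing 𝔅] [StarRing 𝔅] [NormedStarGroup 𝔅] [CompleteSpace 𝔅]
  [NormedSpace ℂ 𝔅] [IsScalarTower ℂ 𝔅 𝔅] [SMulCommClass ℂ 𝔅 𝔅] [StarModule ℂ 𝔅]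

/-- The direct sum of a family of representations. -/
def familyRep {ι : Type u} (F : ι → HilbertRep 𝔅) :
    𝔅 →⋆ₙₐ[ℂ] lp (fun i => (F i).H →L[ℂ] (F i).H) ∞ where
  toFun b := ⟨fun i => (F i).toHom b,
    memℓp_infty ⟨‖b‖, by rintro _ ⟨i, rfl⟩; exact norm_hom_le (F i).toHom b⟩⟩
  map_smul' c b := lp.ext (funext fun i => map_smul (F i).toHom c b)
  map_zero' := lp.ext (funext fun i => map_zero (F i).toHom)
  map_add' a b := lp.ext (funext fun i => map_add (F i).toHom a b)
  map_mul' a b := lp.ext (funext fun i => map_mul (F i).toHom a b)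
  map_star' b := lp.ext (funext fun i => map_star (F i).toHom b)

variable (𝔅) in
-- The enveloping algebra lies one universe too high for the rigid symmetry hypothesis. Choosing one
-- representation for each element not killed by all of them gives a small direct sum with no larger
-- kernel.
theorem exists_faithful_on_enveloping :
    ∃ (B : Type u) (_ : NonUnitalCStarAlgebra B) (ρ : 𝔅 →⋆ₙₐ[ℂ] B),
      ∀ b, ρ b = 0 → toEnveloping 𝔅 b = 0 := by
  let F : {b : 𝔅 // ∃ π : HilbertRep 𝔅, π.toHom b ≠ 0} → HilbertRep 𝔅 := fun b => b.2.choose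
  refine ⟨lp (fun i => (F i).H →L[ℂ] (F i).H) ∞, inferInstance, familyRep F, fun b hb => ?_⟩
  refine Subtype.ext (lp.ext (funext fun π => ?_))
  by_contra h
  let i : {b : 𝔅 // ∃ π : HilbertRep 𝔅, π.toHom b ≠ 0} := ⟨b, π, h⟩
  have h1 : (F i).toHom b ≠ 0 := i.2.choose_spec
  have h2 : ((familyRep F b : lp (fun i => (F i).H →L[ℂ] (F i).H) ∞) : ∀ i, _) i = 0 := by
    rw [hb]
    rfl
  exact h1 h2

end Family

/-! ### Symmetry of the twisted `ℓ¹`-algebra -/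

namespace TwistedAction

open L1

variable {G : Type u} [Group G] {A : Type v} [CStarAlgebra A] (S : TwistedAction G A)

/-- The inclusion of the coefficient algebra. -/
def coeffHom : A →⋆ₙₐ[ℂ] S.TwistedL1 where
  toFun a := single 1 a
  map_smul' c a := map_smul (singleL S.fibers 1) c a
  map_zero' := map_zero (singleL S.fibers 1)
  map_add' a b := map_add (singleL S.fibers 1) a b
  map_mul' a b := by
    rw [single_mul_single, fibers_mul, S.α_one, S.ω_one_left, OneMemClass.coe_one, mul_one, mul_one]
  map_star' a := by
    have h := star_single (S := S.fibers) 1 a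
    rw [inv_one] at h
    rw [h, fibers_inv, S.α_one, S.ω_one_left, OneMemClass.coe_one, star_one, one_mul]

theorem coeffHom_apply (a : A) : S.coeffHom a = single 1 a := rfl

variable {B : Type w} [NonUnitalCStarAlgebra B] (ρ : S.TwistedL1 →⋆ₙₐ[ℂ] B)

theorem norm_rho_single_le (x : G) (a : A) : ‖ρ (single x a)‖ ≤ ‖a‖ :=
  (norm_hom_le ρ _).trans_eq (norm_single x a)

/-- Lift in the coefficient algebra, where `a ↦ ρ (single 1 a)` is a homomorphism of `C^*`-algebras,
and translate to `x`. Since `ρ (single x 1)` is a contraction, translation costs no norm. -/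
theorem exists_lift_single (x : G) (a : A) :
    ∃ a', ρ (single x a') = ρ (single x a) ∧ ‖a'‖ ≤ 2 * ‖ρ (single x a)‖ := by
  obtain ⟨a', h, hn⟩ := exists_lift_norm_le (ρ.comp S.coeffHom) a
  simp only [NonUnitalStarAlgHom.comp_apply, coeffHom_apply] at h hn
  refine ⟨a', ?_, hn.trans ?_⟩
  · rw [← S.single_one_mul_single x a', ← S.single_one_mul_single x a, map_mul, map_mul, h]
  · have h1 : ‖(1 : A)‖ ≤ 1 := by
      rcases subsingleton_or_nontrivial A with hA | hA
      · rw [Subsingleton.elim (1 : A) 0, norm_zero]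
        exact zero_le_one
      · exact (CStarRing.norm_one (E := A)).le
    have h2 : ‖ρ (star (single x 1))‖ ≤ 1 := by
      rw [map_star, norm_star]
      exact (S.norm_rho_single_le ρ x 1).trans h1
    rw [← S.single_mul_star_single x a, map_mul]
    refine mul_le_mul_of_nonneg_left ?_ zero_le_two
    exact (norm_mul_le _ _).trans (mul_le_of_le_one_right (norm_nonneg _) h2)

theorem summable_norm_rho_single (f : S.TwistedL1) :
    Summable fun x => ‖ρ (single x (f x))‖ :=
  (summable_norm f).of_nonneg_of_le (fun _ => norm_nonneg _)
    fun x => S.norm_rho_single_le ρ x (f x)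

/-- A `*`-homomorphism `ρ` into a `C^*`-algebra `B` embeds the graded algebra `ℓ¹_{α,ω}(G; A)`
diagonally into `ℓ¹(G; B)`. -/
def diagonal : S.TwistedL1 →⋆ₙₐ[ℂ] L1 (plainFibers G B) where
  toFun f := L1.mk (fun x => ρ (single x (f x))) (S.summable_norm_rho_single ρ f)
  map_smul' c f := ext fun x => by
    rw [mk_apply, L1.smul_apply, ← singleL_apply, map_smul, map_smul]
    rfl
  map_zero' := ext fun x => by
    rw [mk_apply, L1.zero_apply, ← singleL_apply, map_zero, map_zero]
    rfl
  map_add' f g := ext fun x => by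
    rw [mk_apply, L1.add_apply, ← singleL_apply, map_add, map_add]
    rfl
  map_mul' f g := ext fun x => by
    have hρ : Continuous ρ := by
      refine AddMonoidHomClass.continuous_of_bound ρ 1 fun x => ?_
      simpa using norm_hom_le ρ x
    have h1 := ((summable_conv f g x).hasSum.mapL (singleL S.fibers x)).map
      (ρ : S.TwistedL1 →+ B) hρ
    rw [mk_apply, mul_apply, plain_mul_apply]
    refine h1.tsum_eq.symm.trans (tsum_congr fun y => ?_)
    rw [mk_apply, mk_apply, ← map_mul, single_mul_single, mul_inv_cancel_left]
    rfl
  map_star' f := ext fun x => by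
    rw [mk_apply, star_apply, plain_star_apply, mk_apply, ← map_star, star_single]

theorem norm_diagonal_le (f : S.TwistedL1) : ‖S.diagonal ρ f‖ ≤ ‖f‖ := by
  rw [norm_eq, norm_eq]
  exact (summable_norm _).tsum_le_tsum (fun x => S.norm_rho_single_le ρ x (f x)) (summable_norm f)

theorem exists_lift_diagonal (f : S.TwistedL1) :
    ∃ f', S.diagonal ρ f' = S.diagonal ρ f ∧ ‖f'‖ ≤ 2 * ‖S.diagonal ρ f‖ := by
  choose g hg hn using fun x => S.exists_lift_single ρ x (f x)
  have hs : Summable fun x => 2 * ‖S.diagonal ρ f x‖ := (summable_norm _).mul_left 2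
  have hgs : Summable fun x => ‖g x‖ := hs.of_nonneg_of_le (fun _ => norm_nonneg _) hn
  refine ⟨L1.mk g hgs, ext hg, ?_⟩
  rw [norm_eq, norm_eq, ← tsum_mul_left]
  exact hgs.tsum_le_tsum hn hs

/-- By continuity `ρ f` is the sum of the coordinates `ρ (single x (f x))` of `diagonal ρ f`. -/
theorem rho_eq_zero_of_diagonal_eq_zero {f : S.TwistedL1} (hf : S.diagonal ρ f = 0) : ρ f = 0 := by
  have hρ : Continuous ρ := by
    refine AddMonoidHomClass.continuous_of_bound ρ 1 fun x => ?_
    simpa using norm_hom_le ρ x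
  have h := (hasSum_single_self f).map (ρ : S.TwistedL1 →+ B) hρ
  refine h.unique ?_
  convert! hasSum_zero using 2 with x
  have := congrArg (fun g : L1 (plainFibers G B) => g x) hf
  exact this

/-- If `G` is rigidly symmetric, then the elements `star f * f` of the twisted `ℓ¹`-algebra have
non-negative spectrum modulo the kernel of the canonical map to the crossed product. -/
theorem exists_inverse_mod_ker (hG : RigidlySymmetric.{u, max u v} G) (f : S.TwistedL1) {z : ℂ}
    (hz : ¬ (0 ≤ z.re ∧ z.im = 0)) :
    ∃ y, S.toCrossedProduct (y * (algebraMap ℂ S.TwistedL1 z - star f * f) - 1) = 0 ∧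
      S.toCrossedProduct ((algebraMap ℂ S.TwistedL1 z - star f * f) * y - 1) = 0 := by
  obtain ⟨B, _, ρ, hρ⟩ := exists_faithful_on_enveloping S.TwistedL1
  have hsym : ∀ w ∈ quasispectrum ℂ (S.diagonal ρ (star f * f)), 0 ≤ w.re ∧ w.im = 0 := by
    rw [map_mul, map_star]
    exact hG B (S.diagonal ρ f)
  obtain ⟨y, h1, h2⟩ := exists_quasiInverse_of_controlled_lift
    (S.diagonal ρ : S.TwistedL1 →ₙₐ[ℂ] L1 (plainFibers G B)) (S.norm_diagonal_le ρ) zero_lt_two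
    (S.exists_lift_diagonal ρ) hsym hz
  have hz0 : z ≠ 0 := by
    rintro rfl
    simp at hz
  -- Multiplying `z⁻¹ + y` with `z - star f * f` and subtracting `1` gives exactly the elements that
  -- `diagonal` annihilates.
  refine ⟨algebraMap ℂ S.TwistedL1 z⁻¹ + y, ?_, ?_⟩
  · refine hρ _ (S.rho_eq_zero_of_diagonal_eq_zero ρ ?_)
    rw [← h1]
    refine congrArg (S.diagonal ρ) ?_
    rw [add_mul, mul_sub, mul_sub, ← map_mul, inv_mul_cancel₀ hz0, map_one, ← Algebra.smul_def,
      ← Algebra.commutes, ← Algebra.smul_def]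
    abel
  · refine hρ _ (S.rho_eq_zero_of_diagonal_eq_zero ρ ?_)
    rw [← h2]
    refine congrArg (S.diagonal ρ) ?_
    rw [mul_add, sub_mul, sub_mul, ← map_mul, mul_inv_cancel₀ hz0, map_one, ← Algebra.commutes,
      ← Algebra.smul_def, ← Algebra.smul_def]
    abel

end TwistedAction

/-! ### Compact and Fredholm operators -/

section Operators

variable {H : Type w} [NormedAddCommGroup H] [InnerProductSpace ℂ H] [CompleteSpace H]

theorem isCompactOperator_of_finiteDimensional_range {T : H →L[ℂ] H}
    (hT : FiniteDimensional ℂ T.range) : IsCompactOperator T := by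
  have hid : IsCompactOperator (_root_.id : T.range → T.range) :=
    (isCompactOperator_id_iff_finiteDimensional (𝕜 := ℂ)).2 hT
  exact (hid.comp_clm T.rangeRestrict).clm_comp T.range.subtypeL

/-- A Fredholm operator is invertible modulo compact operators. -/
theorem exists_parametrix {T : H →L[ℂ] H} (hT : T.IsFredholm) :
    ∃ V K L : H →L[ℂ] H, IsCompactOperator K ∧ IsCompactOperator L ∧
      V * T = 1 + K ∧ T * V = 1 + L := by
  obtain ⟨V, hl, hr⟩ := hT.exists_isQuasiInverse
  refine ⟨V, V * T - 1, T * V - 1, ?_, ?_, by abel, by abel⟩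
  · refine isCompactOperator_of_finiteDimensional_range ?_
    have h := LinearMap.FiniteRangeSetoid.equiv_iff_hasNoetherianRange.1 hl
    have h' : IsNoetherian ℂ (V * T - 1 : H →L[ℂ] H).range := h
    infer_instance
  · refine isCompactOperator_of_finiteDimensional_range ?_
    have h := LinearMap.FiniteRangeSetoid.equiv_iff_hasNoetherianRange.1 hr
    have h' : IsNoetherian ℂ (T * V - 1 : H →L[ℂ] H).range := h
    infer_instance

/-- Test on the rank-one operator `⟪x, ·⟫ x`, evaluated at `x`. -/
theorem eq_one_of_mul_compact {P : H →L[ℂ] H}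
    (hP : ∀ K : H →L[ℂ] H, IsCompactOperator K → P * K = K) : P = 1 := by
  ext x
  rcases eq_or_ne x 0 with rfl | hx
  · simp
  have hK : IsCompactOperator (InnerProductSpace.rankOne ℂ x x : H →L[ℂ] H) := by
    refine isCompactOperator_of_finiteDimensional_range ?_
    refine Submodule.finiteDimensional_of_le (S₂ := ℂ ∙ x) ?_
    rintro _ ⟨y, rfl⟩
    exact Submodule.smul_mem _ _ (Submodule.mem_span_singleton_self x)
  have h := congrArg (fun T : H →L[ℂ] H => T x) (hP _ hK)
  simp only [mul_apply_eq_comp, InnerProductSpace.rankOne_apply, map_smul] at h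
  exact smul_right_injective H (inner_self_ne_zero (𝕜 := ℂ).2 hx) h

/-- If `V T = 1 + K`, then `2 ‖V‖² T* T + 2 K* K ≥ 1`. -/
theorem one_le_of_mul_eq_one_add {T V K : H →L[ℂ] H} (h : V * T = 1 + K) :
    1 ≤ (2 * ‖V‖ ^ 2) • (star T * T) + (2 : ℝ) • (star K * K) := by
  have e : (1 : H →L[ℂ] H) = V * T - K := by rw [h]; abel
  have h1 : star (V * T) * (V * T) ≤ ‖V‖ ^ 2 • (star T * T) := by
    have h2 := star_left_conjugate_le_conjugate
      (CStarAlgebra.star_mul_le_algebraMap_norm_sq (a := V)) T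
    rw [Algebra.algebraMap_eq_smul_one, mul_smul_comm, mul_one, smul_mul_assoc] at h2
    rw [star_mul]
    simpa only [mul_assoc] using h2
  have h3 : (2 : ℝ) • (star (V * T) * (V * T)) ≤ (2 * ‖V‖ ^ 2) • (star T * T) := by
    rw [mul_smul]
    exact smul_le_smul_of_nonneg_left h1 zero_le_two
  have h4 : (1 : H →L[ℂ] H) ≤ (2 : ℝ) • (star (V * T) * (V * T)) + (2 : ℝ) • (star K * K) := by
    have e1 : (1 : H →L[ℂ] H) = star (V * T - K) * (V * T - K) := by rw [← e, star_one, one_mul]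
    rw [← sub_nonneg]
    conv_rhs => rw [e1]
    -- The parallelogram identity for `V * T` and `K`.
    have e2 : (2 : ℝ) • (star (V * T) * (V * T)) + (2 : ℝ) • (star K * K) -
        star (V * T - K) * (V * T - K) = star (V * T + K) * (V * T + K) := by
      simp only [two_smul, star_sub, star_add, sub_mul, mul_sub, add_mul, mul_add]
      abel
    rw [e2]
    exact star_mul_self_nonneg _
  exact h4.trans (add_le_add_left h3 _)

/-- From `1 ≤ W ≤ M` follows `0 ≤ M - W ≤ M - 1`. This turns the operator inequality into a norm
bound that isometric and contractive homomorphisms transport. -/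
theorem exists_norm_sub_le_of_one_le {W : H →L[ℂ] H} (hW : 1 ≤ W) :
    ∃ M : ℝ, 1 ≤ M ∧ ‖algebraMap ℝ (H →L[ℂ] H) M - W‖ ≤ M - 1 := by
  have hWs : IsSelfAdjoint W := .of_nonneg (zero_le_one.trans hW)
  have h1 : ‖(1 : H →L[ℂ] H)‖ ≤ 1 := ContinuousLinearMap.norm_id_le
  refine ⟨‖W‖ + 1, by linarith [norm_nonneg W], ?_⟩
  have h2 : W ≤ algebraMap ℝ (H →L[ℂ] H) (‖W‖ + 1) :=
    hWs.le_algebraMap_norm_self.trans (algebraMap_mono _ (by linarith))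
  have h3 : algebraMap ℝ (H →L[ℂ] H) (‖W‖ + 1) - W ≤ algebraMap ℝ (H →L[ℂ] H) (‖W‖ + 1 - 1) := by
    rw [map_sub, map_one]
    exact sub_le_sub_left hW _
  refine (CStarAlgebra.norm_le_norm_of_nonneg_of_le (sub_nonneg.2 h2) h3).trans ?_
  rw [norm_algebraMap, add_sub_cancel_right, norm_norm]
  exact mul_le_of_le_one_right (norm_nonneg _) h1

end Operators

/-! ### Representations of the enveloping algebra -/

section EvalRep

variable {𝔅 : Type u} [NonUnitalNormedRing 𝔅] [StarRing 𝔅] [NormedStarGroup 𝔅] [CompleteSpace 𝔅]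
  [NormedSpace ℂ 𝔅] [IsScalarTower ℂ 𝔅 𝔅] [SMulCommClass ℂ 𝔅 𝔅] [StarModule ℂ 𝔅]

theorem continuous_hom {D : Type*} [NonUnitalCStarAlgebra D] (φ : 𝔅 →⋆ₙₐ[ℂ] D) :
    Continuous φ := by
  refine AddMonoidHomClass.continuous_of_bound φ 1 fun x => ?_
  simpa using norm_hom_le φ x

/-- The extension of a representation to the enveloping `C^*`-algebra. -/
def evalRep (π : HilbertRep 𝔅) : Enveloping 𝔅 →⋆ₙₐ[ℂ] (π.H →L[ℂ] π.H) where
  toFun e := e.1.1 π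
  map_smul' _ _ := rfl
  map_zero' := rfl
  map_add' _ _ := rfl
  map_mul' _ _ := rfl
  map_star' _ := rfl

theorem evalRep_toEnveloping (π : HilbertRep 𝔅) (b : 𝔅) :
    evalRep π (toEnveloping 𝔅 b) = π.toHom b := rfl

theorem denseRange_toEnveloping : DenseRange (toEnveloping 𝔅) := by
  intro e
  have hs : Subtype.val '' Set.range (toEnveloping 𝔅) =
      (NonUnitalStarAlgHom.range (universalRep 𝔅) : Set (RepProduct 𝔅)) := by
    ext x
    constructor
    · rintro ⟨_, ⟨b, rfl⟩, rfl⟩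
      exact ⟨b, rfl⟩
    · rintro ⟨b, rfl⟩
      exact ⟨_, ⟨b, rfl⟩, rfl⟩
  exact closure_subtype.2 (closure_mono hs.ge e.2)

end EvalRep

/-! ### Left inverses modulo the elements with compact image -/

namespace TwistedAction

open L1

variable {G : Type u} [Group G] {A : Type v} [CStarAlgebra A] (S : TwistedAction G A)

theorem toCrossedProduct_one_mul (e : S.CrossedProduct) : S.toCrossedProduct 1 * e = e := by
  refine denseRange_toEnveloping.induction_on
    (p := fun e : S.CrossedProduct => S.toCrossedProduct 1 * e = e) e ?_ fun f => ?_
  · exact isClosed_eq (continuous_const.mul continuous_id) continuous_id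
  · change S.toCrossedProduct 1 * S.toCrossedProduct f = S.toCrossedProduct f
    rw [← map_mul, one_mul]

theorem star_mem_crossedIdeal {J : Ideal A} (hJ_star : ∀ a ∈ J, star a ∈ J)
    (hJ_inv : ∀ x : G, ∀ a ∈ J, S.α x a ∈ J) {e : S.CrossedProduct} (he : e ∈ S.crossedIdeal J) :
    star e ∈ S.crossedIdeal J := by
  refine map_mem_closure continuous_star he ?_
  rintro _ ⟨f, hf, rfl⟩
  refine ⟨star f, fun x => ?_, map_star _ _⟩
  rw [S.twisted_star_apply]
  exact J.mul_mem_left _ (hJ_star _ (hJ_inv _ _ (hf _)))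

section Representation

variable {H : Type w} [NormedAddCommGroup H] [InnerProductSpace ℂ H] [CompleteSpace H]
  (Pi : S.CrossedProduct →⋆ₙₐ[ℂ] (H →L[ℂ] H))

/-- `Pi` is not assumed unital: the unit acts as a left unit on every compact operator, because
these all lie in the range of `Pi`. -/
theorem Pi_one {J : Ideal A} (hPiJ : Pi '' S.crossedIdeal J = {T : H →L[ℂ] H | IsCompactOperator T}) :
    Pi (S.toCrossedProduct 1) = 1 := by
  refine eq_one_of_mul_compact fun K hK => ?_
  have hK' : K ∈ Pi '' S.crossedIdeal J := by rw [hPiJ]; exact hK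
  obtain ⟨e, -, rfl⟩ := hK'
  rw [← map_mul, S.toCrossedProduct_one_mul]

/-- The elements of the twisted `ℓ¹`-algebra that are represented by compact operators. -/
def compactIdeal {J : Ideal A} (hJ_star : ∀ a ∈ J, star a ∈ J)
    (hJ_inv : ∀ x : G, ∀ a ∈ J, S.α x a ∈ J)
    (hPiJ : Pi '' S.crossedIdeal J = {T : H →L[ℂ] H | IsCompactOperator T}) :
    ClosedStarIdeal S.TwistedL1 where
  toIdeal :=
    { carrier := {f | IsCompactOperator (Pi (S.toCrossedProduct f))}
      zero_mem' := by
        rw [Set.mem_ofPred_eq, map_zero, map_zero]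
        exact isCompactOperator_zero
      add_mem' := fun {f g} hf hg => by
        rw [Set.mem_ofPred_eq, map_add, map_add]
        exact hf.add hg
      smul_mem' := fun g f hf => by
        rw [Set.mem_ofPred_eq, smul_eq_mul, map_mul, map_mul]
        exact IsCompactOperator.clm_comp hf (Pi (S.toCrossedProduct g)) }
  isTwoSided := ⟨fun {f} g hf => by
    change IsCompactOperator (Pi (S.toCrossedProduct (f * g)))
    rw [map_mul, map_mul]
    exact IsCompactOperator.comp_clm hf (Pi (S.toCrossedProduct g))⟩
  isClosed := by
    have h : Continuous fun f => Pi (S.toCrossedProduct f) :=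
      (continuous_hom Pi).comp (continuous_hom S.toCrossedProduct)
    exact isClosed_setOfPred_isCompactOperator.preimage h
  star_mem f hf := by
    -- Adjoints of compact operators are compact here because the compacts are the image of the
    -- self-adjoint set `S.crossedIdeal J`.
    have hf' : Pi (S.toCrossedProduct f) ∈ Pi '' S.crossedIdeal J := by rw [hPiJ]; exact hf
    obtain ⟨e, he, hef⟩ := hf'
    have : Pi (star e) ∈ Pi '' S.crossedIdeal J :=
      ⟨_, S.star_mem_crossedIdeal hJ_star hJ_inv he, rfl⟩
    rw [hPiJ, map_star, hef, ← map_star, ← map_star] at this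
    exact this

/-- An element of the twisted `ℓ¹`-algebra whose image is left invertible modulo compact operators
is left invertible modulo the elements with compact image. -/
theorem exists_left_inverse_mod_compact (hG : RigidlySymmetric.{u, max u v} G)
    {J : Ideal A} (hJ_star : ∀ a ∈ J, star a ∈ J) (hJ_inv : ∀ x : G, ∀ a ∈ J, S.α x a ∈ J)
    (hPi : Function.Injective Pi)
    (hPiJ : Pi '' S.crossedIdeal J = {T : H →L[ℂ] H | IsCompactOperator T})
    {f : S.TwistedL1} {V K : H →L[ℂ] H} (hK : IsCompactOperator K)
    (hV : V * Pi (S.toCrossedProduct f) = 1 + K) :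
    ∃ y, IsCompactOperator (Pi (S.toCrossedProduct (y * f - 1))) := by
  set N := S.compactIdeal Pi hJ_star hJ_inv hPiJ with hN
  by_contra! hcon
  obtain ⟨π, ξ, hξ, h1, h0, hker⟩ := N.exists_hilbertRep (fun g z hz => by
    obtain ⟨y, hy1, hy2⟩ := S.exists_inverse_mod_ker hG g hz
    refine ⟨y, ?_, ?_⟩
    · change IsCompactOperator (Pi (S.toCrossedProduct _))
      rw [hy1, map_zero]
      exact isCompactOperator_zero
    · change IsCompactOperator (Pi (S.toCrossedProduct _))
      rw [hy2, map_zero]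
      exact isCompactOperator_zero) hcon
  -- `ℓ¹(G; J)` has compact image, so it lies in `N`, which `π` annihilates; continuity extends this
  -- to the closure.
  have hJ0 : ∀ j ∈ S.crossedIdeal J, evalRep π j = 0 := by
    have hcl : IsClosed {j : S.CrossedProduct | evalRep π j = 0} :=
      isClosed_eq (continuous_hom (evalRep π)) continuous_const
    intro j hj
    refine closure_minimal ?_ hcl hj
    rintro _ ⟨g, hg, rfl⟩
    refine (hker g ?_ : π.toHom g = 0)
    have : Pi (S.toCrossedProduct g) ∈ Pi '' S.crossedIdeal J :=
      ⟨_, subset_closure ⟨g, hg, rfl⟩, rfl⟩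
    rw [hPiJ] at this
    exact this
  have hKK : star K * K ∈ Pi '' S.crossedIdeal J := by
    rw [hPiJ]
    exact IsCompactOperator.clm_comp hK (star K)
  obtain ⟨j, hj, hjK⟩ := hKK
  set c : ℝ := 2 * ‖V‖ ^ 2 with hc
  obtain ⟨M, hM, hMW⟩ := exists_norm_sub_le_of_one_le (one_le_of_mul_eq_one_add hV)
  -- A preimage under `Pi` of `c T*T + 2 K*K`, so `M - e` has norm at most `M - 1`. But `π` kills
  -- `j` and `π(f) ξ = 0`, so `M - e` acts on `ξ` as multiplication by `M`.
  set e : S.CrossedProduct := (c : ℂ) • S.toCrossedProduct (star f * f) + (2 : ℂ) • j with he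
  have hPe : Pi ((M : ℂ) • S.toCrossedProduct 1 - e) = algebraMap ℝ (H →L[ℂ] H) M -
      (c • (star (Pi (S.toCrossedProduct f)) * Pi (S.toCrossedProduct f)) +
        (2 : ℝ) • (star K * K)) := by
    rw [he, map_sub, map_add, map_smul, map_smul, map_smul, S.Pi_one Pi hPiJ, hjK, map_mul,
      map_mul, map_star, map_star, Algebra.algebraMap_eq_smul_one, ← Complex.coe_smul,
      ← Complex.coe_smul, ← Complex.coe_smul, Complex.ofReal_ofNat]
  have hne : ‖(M : ℂ) • S.toCrossedProduct 1 - e‖ ≤ M - 1 := by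
    rw [← NonUnitalStarAlgHom.norm_map Pi hPi, hPe]
    exact hMW
  have hσ : evalRep π ((M : ℂ) • S.toCrossedProduct 1 - e) ξ = (M : ℂ) • ξ := by
    rw [he, map_sub, map_add, map_smul, map_smul, map_smul, hJ0 j hj, evalRep_toEnveloping,
      evalRep_toEnveloping, map_mul, smul_zero, add_zero, sub_apply, _root_.smul_apply,
      _root_.smul_apply, mul_apply_eq_comp, h1, h0, map_zero, smul_zero, sub_zero]
  have hle : ‖(M : ℂ) • ξ‖ ≤ (M - 1) * ‖ξ‖ := by
    rw [← hσ]
    refine (ContinuousLinearMap.le_opNorm _ _).trans ?_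
    exact mul_le_mul_of_nonneg_right ((norm_hom_le (evalRep π) _).trans hne) (norm_nonneg _)
  rw [norm_smul, Complex.norm_real, Real.norm_eq_abs, abs_of_pos (by linarith)] at hle
  have := norm_pos_iff.2 hξ
  linarith

end Representation

end TwistedAction

end TwistedCrossed

end

/-! ### Fredholm inverse closedness -/

theorem mainTheorem4 {G : Type u} [Group G]
    (hG : TwistedCrossed.RigidlySymmetric.{u, max u v} G)
    {A : Type v} [CStarAlgebra A] (S : TwistedCrossed.TwistedAction G A)
    (J : Ideal A) [J.IsTwoSided] (hJ_closed : IsClosed (J : Set A))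
    (hJ_star : ∀ a ∈ J, star a ∈ J) (hJ_inv : ∀ x : G, ∀ a ∈ J, S.α x a ∈ J)
    {H : Type w} [NormedAddCommGroup H] [InnerProductSpace ℂ H] [CompleteSpace H]
    (Pi : S.CrossedProduct →⋆ₙₐ[ℂ] (H →L[ℂ] H)) (hPi : Function.Injective Pi)
    (hPiJ : Pi '' S.crossedIdeal J = {T : H →L[ℂ] H | IsCompactOperator T}) :
    TwistedCrossed.FredholmInverseClosed
      (NonUnitalStarAlgHom.range (Pi.comp S.toCrossedProduct)) := by
  rintro _ ⟨f, rfl⟩ hT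
  obtain ⟨V, K, L, hK, hL, hVT, hTV⟩ := TwistedCrossed.exists_parametrix hT
  obtain ⟨y, hy⟩ := S.exists_left_inverse_mod_compact Pi hG hJ_star hJ_inv hPi hPiJ hK hVT
  set T : H →L[ℂ] H := Pi (S.toCrossedProduct f) with hTdef
  change T * V = 1 + L at hTV
  set R : H →L[ℂ] H := Pi (S.toCrossedProduct y) with hR
  set C : H →L[ℂ] H := Pi (S.toCrossedProduct (y * f - 1)) with hC
  have hRT : R * T = 1 + C := by
    rw [hC, map_sub, map_sub, map_mul, map_mul, S.Pi_one Pi hPiJ]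
    abel
  -- The second compact operator comes from evaluating `T R T V` in two ways, as `T R (1 + L)` and
  -- as `T (1 + C) V = 1 + L + T C V`.
  refine ⟨R, ⟨y, rfl⟩, C, L + T * C * V - T * R * L, hy, ?_, hRT, ?_⟩
  · exact (hL.add ((IsCompactOperator.clm_comp hy T).comp_clm V)).sub
      (IsCompactOperator.clm_comp hL (T * R))
  · change T * R = _
    have h1 : T * R * (T * V) = T * (R * T) * V := by simp only [mul_assoc]
    rw [hTV, hRT, mul_add, mul_add, add_mul, mul_one, mul_one, hTV] at h1
    exact (eq_sub_of_add_eq h1).trans (by abel)
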